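/- Let $R$ be a commutative Noetherian ring, $\mathfrak a$ an ideal of $R$, $M$ a finitely generated $R$-module and $N$ an Artinian $R$-module. For an ideal $\mathfrak b$ of $R$ write $(0:_N\mathfrak b)=\{x\in N:\mathfrak b x=0\}$. Let $\widehat R^{\mathfrak a}=\varprojlim_n R/\mathfrak a^n$ be the $\mathfrak a$-adic completion of $R$, and for $i\ge 0$ let $$H^{\mathfrak a}_i(M,N)=\varprojlim_n \operatorname{Tor}^R_i(M/\mathfrak a^nM,N),\qquad H^{\mathfrak a}_i(N)=H^{\mathfrak a}_i(R,N)=\varprojlim_n \operatorname{Tor}^R_i(R/\mathfrak a^n,N),$$ the transition maps being induced by the natural projections. These are $\widehat R^{\mathfrak a}$-modules via $(r_n+\mathfrak a^n)_n\,(x_n)_n=(r_nx_n)_n$. Then: (i) If $\operatorname{Tor}^R_i(M,N)$ has finite length for all $i\ge 0$, then $(0:_N\operatorname{Ann}_R(M))$ has finite length. (ii) If $H^{\mathfrak a}_i(M,N)$ is a finitely generated $\widehat R^{\mathfrak a}$-module for all $i\ge 0$, then $(0:_N\mathfrak a+\operatorname{Ann}_R(M))$ has finite length. In particular, if $H^{\mathfrak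 a}_i(N)$ is a finitely generated $\widehat R^{\mathfrak a}$-module for all $i\ge 0$, then $(0:_N\mathfrak a)$ has finite length. Moreover, if $R$ is semi-local (that is, has only finitely many maximal ideals) and is complete with respect to its Jacobson radical, then the converse of each of these three implications also holds. -/

import Mathlib

open CategoryTheory

universe u

noncomputable section

namespace LocalHom

variable {R : Type u} [CommRing R]

/-- The `R`-module `Tor_i^R(M, N)`, via Mathlib's derived functors on the category of `R`-modules. -/
abbrev TorMod (R : Type u) [CommRing R] (M N : Type u) [AddCommGroup M] [Module R M]
    [AddCommGroup N] [Module R N] (i : ℕ) : Type u :=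
  ((Tor (ModuleCat.{u} R) i).obj (ModuleCat.of R M)).obj (ModuleCat.of R N)

/-- The `R`-linear map `Tor_i^R(M, N) → Tor_i^R(M', N)` induced by `f : M → M'`. -/
def torMap {M M' : Type u} [AddCommGroup M] [Module R M] [AddCommGroup M'] [Module R M']
    (f : M →ₗ[R] M') (N : Type u) [AddCommGroup N] [Module R N] (i : ℕ) :
    TorMod R M N i →ₗ[R] TorMod R M' N i :=
  (((Tor (ModuleCat.{u} R) i).map (ModuleCat.ofHom f)).app (ModuleCat.of R N)).hom

/-- A scalar that kills every term of a complex kills its homology. -/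
lemma smul_homology_eq_zero (K : ChainComplex (ModuleCat.{u} R) ℕ) (i : ℕ) (r : R)
    (h : ∀ x : K.X i, r • x = 0) (y : K.homology i) : r • y = 0 := by
  obtain ⟨z, rfl⟩ := (ModuleCat.epi_iff_surjective (K.homologyπ i)).1 inferInstance y
  have hz : r • z = 0 := by
    apply (ModuleCat.mono_iff_injective (K.iCycles i)).1 inferInstance
    rw [map_smul, h, map_zero]
  rw [← map_smul, hz, map_zero]

/-- A scalar that kills `M` kills `Tor_i^R(M, N)`. -/
lemma smul_tor_eq_zero {M N : Type u} [AddCommGroup M] [Module R M] [AddCommGroup N] [Module R N]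
    (i : ℕ) (r : R) (h : ∀ x : M, r • x = 0) (y : TorMod R M N i) : r • y = 0 := by
  let P := projectiveResolution (ModuleCat.of R N)
  let e := P.isoLeftDerivedObj ((MonoidalCategory.tensoringLeft (ModuleCat.{u} R)).obj
    (ModuleCat.of R M)) i
  have he : Function.Injective e.hom := (ModuleCat.mono_iff_injective e.hom).1 inferInstance
  refine he (Eq.trans ?_ (map_zero e.hom.hom).symm)
  refine (map_smul e.hom.hom r y).trans ?_
  refine smul_homology_eq_zero _ i r ?_ _
  intro x
  change TensorProduct R M (P.complex.X i) at x
  change r • x = 0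
  induction x using TensorProduct.induction_on with
  | zero => simp
  | tmul a b => rw [TensorProduct.smul_tmul', h, TensorProduct.zero_tmul]
  | add a b ha hb => rw [smul_add, ha, hb, add_zero]

variable (𝔞 : Ideal R) (M N : Type u) [AddCommGroup M] [Module R M] [AddCommGroup N] [Module R N]
  (i : ℕ)

/-- The `n`-th module `Tor_i^R(M / 𝔞ⁿ M, N)` of the inverse system defining local homology. -/
def Term (n : ℕ) : Type u := TorMod R (M ⧸ (𝔞 ^ n • ⊤ : Submodule R M)) N i

instance (n : ℕ) : AddCommGroup (Term 𝔞 M N i n) :=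
  inferInstanceAs (AddCommGroup (TorMod R (M ⧸ (𝔞 ^ n • ⊤ : Submodule R M)) N i))

instance (n : ℕ) : Module R (Term 𝔞 M N i n) :=
  inferInstanceAs (Module R (TorMod R (M ⧸ (𝔞 ^ n • ⊤ : Submodule R M)) N i))

lemma term_isTorsion (n : ℕ) : Module.IsTorsionBySet R (Term 𝔞 M N i n) (𝔞 ^ n : Ideal R) := by
  rintro y ⟨r, hr⟩
  refine smul_tor_eq_zero i r (fun x => ?_) y
  obtain ⟨m, rfl⟩ := Submodule.Quotient.mk_surjective _ x
  rw [← Submodule.Quotient.mk_smul, Submodule.Quotient.mk_eq_zero]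
  exact Submodule.smul_mem_smul hr trivial

/-- The transition maps `Tor_i^R(M / 𝔞ⁿ M, N) → Tor_i^R(M / 𝔞ᵐ M, N)` for `m ≤ n`, induced by the
natural projections `M / 𝔞ⁿ M → M / 𝔞ᵐ M`. -/
def transition {m n : ℕ} (h : m ≤ n) : Term 𝔞 M N i n →ₗ[R] Term 𝔞 M N i m :=
  torMap (Submodule.factorPow 𝔞 M h) N i

/-- The `𝔞`-adic completion of `R` acts on `Tor_i^R(M / 𝔞ⁿ M, N)` through `R / 𝔞ⁿ`, since `𝔞ⁿ`
kills this module. -/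
instance (n : ℕ) : Module (AdicCompletion 𝔞 R) (Term 𝔞 M N i n) :=
  letI := (term_isTorsion 𝔞 M N i n).module
  Module.compHom _ (AdicCompletion.evalₐ 𝔞 n).toRingHom

/-- A sequence of residue classes `(rₙ + 𝔞ⁿ)ₙ` acts on the `n`-th term as multiplication by `rₙ`. -/
lemma completion_smul_term {n : ℕ} (r : AdicCompletion 𝔞 R) (s : R)
    (h : AdicCompletion.evalₐ 𝔞 n r = Ideal.Quotient.mk (𝔞 ^ n) s) (x : Term 𝔞 M N i n) :
    r • x = s • x := by
  let _ := (term_isTorsion 𝔞 M N i n).module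
  change AdicCompletion.evalₐ 𝔞 n r • x = s • x
  rw [h]
  exact (term_isTorsion 𝔞 M N i n).mk_smul s x

/-- The generalized local homology module `H^𝔞_i(M, N) = lim_n Tor_i^R(M / 𝔞ⁿ M, N)`, as the module
of compatible families over the `𝔞`-adic completion of `R`, with
`(rₙ + 𝔞ⁿ)ₙ (xₙ)ₙ = (rₙ xₙ)ₙ`. -/
def genLocalHomology : Submodule (AdicCompletion 𝔞 R) (∀ n : ℕ, Term 𝔞 M N i n) where
  carrier := {x | ∀ ⦃m n : ℕ⦄ (h : m ≤ n), transition 𝔞 M N i h (x n) = x m}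
  add_mem' := by
    intro x y hx hy m n h
    rw [Pi.add_apply, map_add, hx h, hy h, Pi.add_apply]
  zero_mem' := by
    intro m n h
    rw [Pi.zero_apply, map_zero, Pi.zero_apply]
  smul_mem' := by
    intro r x hx m n h
    obtain ⟨s, hs⟩ := Submodule.Quotient.mk_surjective _ (r.val n)
    have hn : AdicCompletion.evalₐ 𝔞 n r = Ideal.Quotient.mk (𝔞 ^ n) s := by
      have H : (𝔞 ^ n • ⊤ : Ideal R) ≤ 𝔞 ^ n := (Ideal.mul_top _).le
      rw [← AdicCompletion.factor_eval_eq_evalₐ 𝔞 r H]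
      change Ideal.Quotient.factor H (r.val n) = _
      rw [← hs]
      rfl
    have hm : AdicCompletion.evalₐ 𝔞 m r = Ideal.Quotient.mk (𝔞 ^ m) s := by
      have H : (𝔞 ^ m • ⊤ : Ideal R) ≤ 𝔞 ^ m := (Ideal.mul_top _).le
      rw [← AdicCompletion.factor_eval_eq_evalₐ 𝔞 r H]
      change Ideal.Quotient.factor H (r.val m) = _
      rw [← AdicCompletion.transitionMap_comp_eval_apply 𝔞 R h r, ← hs]
      rfl
    rw [Pi.smul_apply, Pi.smul_apply, completion_smul_term 𝔞 M N i r s hn,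
      completion_smul_term 𝔞 M N i r s hm, map_smul, hx h]

/-- The local homology module `H^𝔞_i(N) = lim_n Tor_i^R(R / 𝔞ⁿ, N)`, that is `H^𝔞_i(R, N)`. -/
abbrev localHomology : Submodule (AdicCompletion 𝔞 R) (∀ n : ℕ, Term 𝔞 R N i n) :=
  genLocalHomology 𝔞 R N i

end LocalHom

end

/-! For finite X the module Tor_i(X, N) is Artinian, as are the submodules of N, so finite length
always means Noetherian. Write I for an ideal such as Ann M or 𝔞 + Ann M. The argument passes
through the family of all finite modules X killed by I.

From M to X: by `induction_of_annihilator`, a property of M that is stable under quotients and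
extensions holds for every finite X killed by Ann M. Noetherianity of Tor_i(-, N) is stable under
extensions by exactness. For a surjection X → Y with kernel K, Tor_{i+1}(Y, N) is caught between
Tor_{i+1}(X, N) and Tor_i(K, N), and induction on i handles K. The same works for finiteness of
H_i^𝔞(-, N) over the completion, a Noetherian ring. The exact sequences come from Artin–Rees and
from the exactness of limits of Artinian modules (`exists_compatible_lift`).

From X to N: all Tor_i(X, N) with X finite and I X = 0 are Noetherian if and only if (0 :_N I) is
(`isNoetherian_torsionBySet_of_tor`, `isNoetherian_tor_of_torsionBySet`). Both directions use
induction over proper submodules of N, passing to ker x when some x ∈ I acts surjectively.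

If 𝔞 X = 0, then H_i^𝔞(X, N) = Tor_i(X, N), which gives (ii) with I = 𝔞 + Ann M. For its converse, a
prime filtration reduces to X = R/p. If 𝔞 ⊄ p, some x ∈ 𝔞 is regular on X, H_i(X)/x H_i(X) embeds in
H_i(X/xX), and Nakayama over the completion concludes. -/

noncomputable section

namespace LocalHom

/-! ### Modules reached from M by quotients and extensions. -/

section ModuleInduction

variable {R : Type u} [CommRing R]

/-- If `𝔭` contains the annihilator of the finite module `M`, an element `r` with `r M ⊆ 𝔭 M` is
nilpotent modulo `𝔭`. -/
lemma mem_of_forall_smul_mem {M : Type u} [AddCommGroup M] [Module R M] [Module.Finite R M]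
    {𝔭 : Ideal R} [𝔭.IsPrime] (h : Module.annihilator R M ≤ 𝔭) {r : R}
    (hr : ∀ m : M, r • m ∈ (𝔭 • ⊤ : Submodule R M)) : r ∈ 𝔭 := by
  -- Cayley–Hamilton: r is a root on M of a monic p with lower coefficients in 𝔭, so p(r) kills M
  -- and lies in 𝔭.
  obtain ⟨p, hp, -, hc, h0⟩ :=
    LinearMap.exists_monic_and_natDegree_eq_and_coeff_mem_pow_and_aeval_eq_zero R
      (LinearMap.lsmul R M r) 𝔭 (by
        rintro _ ⟨m, rfl⟩
        exact hr m)
  have hpr : p.eval r ∈ 𝔭 := by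
    refine h (Module.mem_annihilator.2 fun m => ?_)
    have h1 := congr($h0 m)
    have h2 : LinearMap.lsmul R M r = algebraMap R (Module.End R M) r := rfl
    rwa [h2, Polynomial.aeval_algebraMap_apply, Polynomial.coe_aeval_eq_eval] at h1
  have hq : p.eval r - r ^ p.natDegree ∈ 𝔭 := by
    rw [Polynomial.eval_eq_sum_range, Finset.sum_range_succ, hp.coeff_natDegree, one_mul,
      add_sub_cancel_right]
    refine Ideal.sum_mem _ fun k hk => 𝔭.mul_mem_right _ ?_
    have := hc k
    exact Ideal.pow_le_self (by have := Finset.mem_range.1 hk; omega) this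
  exact Ideal.IsPrime.mem_of_pow_mem ‹_› p.natDegree
    (by simpa using 𝔭.sub_mem hpr hq)

/-- Closure under submodules is not required: for Tor it would call for the next higher degree,
whereas quotients call for a lower one. Noetherian induction on c treats R/c, the prime case being
the essential one; finite modules are then assembled from cyclic ones. -/
theorem induction_of_annihilator [IsNoetherianRing R] (M : Type u) [AddCommGroup M] [Module R M]
    [Module.Finite R M] (P : ∀ (X : Type u) [AddCommGroup X] [Module R X], Prop)
    (quot : ∀ (X Y : Type u) [AddCommGroup X] [Module R X] [AddCommGroup Y] [Module R Y]
      [Module.Finite R X] (f : X →ₗ[R] Y), Function.Surjective f →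
      Module.annihilator R M ≤ Module.annihilator R X → P X → P Y)
    (ext : ∀ (X : Type u) [AddCommGroup X] [Module R X] [Module.Finite R X] (K : Submodule R X),
      Module.annihilator R M ≤ Module.annihilator R X → P K → P (X ⧸ K) → P X)
    (hM : P M) (X : Type u) [AddCommGroup X] [Module R X] [Module.Finite R X]
    (hX : Module.annihilator R M ≤ Module.annihilator R X) : P X := by
  have ann_quot (Y : Type u) [AddCommGroup Y] [Module R Y] (c : Ideal R) (x : Y)
      (hx : Submodule.span R {x} = ⊤) (hc : ∀ r ∈ c, r • x = 0)
      (hMc : Module.annihilator R M ≤ c) (hP : P (R ⧸ c)) : P Y := by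
    refine quot (R ⧸ c) Y (c.liftQ (LinearMap.toSpanSingleton R Y x) ?_) ?_ ?_ hP
    · intro r hr
      exact hc r hr
    · intro y
      obtain ⟨t, rfl⟩ := Submodule.mem_span_singleton.1 (hx ▸ Submodule.mem_top : y ∈ _)
      exact ⟨Ideal.Quotient.mk c t, rfl⟩
    · rwa [Ideal.annihilator_quotient]
  have cyc (c : Ideal R) (hc : Module.annihilator R M ≤ c) : P (R ⧸ c) := by
    revert hc
    refine IsNoetherian.induction (R := R) (M := R)
      (P := fun c : Ideal R => Module.annihilator R M ≤ c → P (R ⧸ c)) (fun (c : Ideal R) ih hc => ?_) c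
    by_cases hp : c.IsPrime
    · -- a quotient of `M` embeds in `R ⧸ c`
      obtain ⟨L, ⟨hL1, hL2⟩, hLmax⟩ := set_has_maximal_iff_noetherian.2
        (inferInstance : IsNoetherian R M)
        {L : Submodule R M | c • ⊤ ≤ L ∧ ∀ r, (∀ m, r • m ∈ L) → r ∈ c}
        ⟨c • ⊤, le_rfl, fun r hr => mem_of_forall_smul_mem hc hr⟩
      obtain ⟨q, hq⟩ : ∃ q, q ∉ L := by
        by_contra! h
        exact hp.ne_top ((Ideal.eq_top_iff_one _).2 (hL2 1 (fun m => h _)))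
      -- Maximality of L: multiplication by some r outside c carries M/L into the cyclic submodule
      -- generated by q.
      obtain ⟨r, hr, hrc⟩ : ∃ r, (∀ m, r • m ∈ L ⊔ Submodule.span R {q}) ∧ r ∉ c := by
        by_contra! h
        refine hLmax (L ⊔ Submodule.span R {q}) ⟨hL1.trans le_sup_left, h⟩ ?_
        refine lt_of_le_of_ne le_sup_left fun h => hq ?_
        rw [h]
        exact Submodule.mem_sup_right (Submodule.mem_span_singleton_self q)
      -- The class of q generates a copy of R/c: if s ∉ c killed it, then s r ∉ c would carry M into
      -- L.
      have hqc (s : R) : s • q ∈ L ↔ s ∈ c := by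
        constructor
        · intro hs
          by_contra hsc
          refine (hp.mul_notMem hsc hrc) (hL2 _ fun m => ?_)
          obtain ⟨l, hl, y, hy, hly⟩ := Submodule.mem_sup.1 (hr m)
          obtain ⟨t, rfl⟩ := Submodule.mem_span_singleton.1 hy
          rw [mul_smul, ← hly, smul_add, smul_comm s t]
          exact L.add_mem (L.smul_mem _ hl) (L.smul_mem _ hs)
        · intro hs
          exact hL1 (Submodule.smul_mem_smul hs trivial)
      let f : R →ₗ[R] M ⧸ L := L.mkQ ∘ₗ LinearMap.toSpanSingleton R M q
      have hker : LinearMap.ker f = c := by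
        ext s
        simp only [f, LinearMap.mem_ker, LinearMap.comp_apply, LinearMap.toSpanSingleton_apply,
          Submodule.mkQ_apply, Submodule.Quotient.mk_eq_zero, hqc]
      have hgr (y : M) : L.mkQ (r • y) ∈ LinearMap.range f := by
        obtain ⟨l, hl, z, hz, hly⟩ := Submodule.mem_sup.1 (hr y)
        obtain ⟨t, rfl⟩ := Submodule.mem_span_singleton.1 hz
        refine ⟨t, ?_⟩
        rw [← hly, map_add]
        simp [f, (Submodule.Quotient.mk_eq_zero L).2 hl]
      let g : M →ₗ[R] LinearMap.range f :=
        LinearMap.codRestrict _ (L.mkQ ∘ₗ LinearMap.lsmul R M r) hgr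
      have hfc : ∀ s ∈ c, ∀ y : LinearMap.range f, s • y = 0 := by
        rintro s hs ⟨_, t, rfl⟩
        ext
        change s • f t = 0
        rw [← map_smul, ← LinearMap.mem_ker, hker]
        exact c.mul_mem_right _ hs
      have hann : Module.annihilator R M ≤ Module.annihilator R (LinearMap.range f) :=
        fun s hs => Module.mem_annihilator.2 (hfc s (hc hs))
      -- This copy of R/c contains r(M/L), a quotient of M. What remains is cyclic and killed by c
      -- and r, so the larger ideal c + (r) covers it.
      have hPV : P (LinearMap.range f) := by
        refine ext _ (LinearMap.range g) hann
          (quot M _ g.rangeRestrict g.surjective_rangeRestrict le_rfl hM) ?_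
        refine ann_quot _ (c ⊔ Ideal.span {r}) ((LinearMap.range g).mkQ ⟨f 1, 1, rfl⟩) ?_ ?_
          (hc.trans le_sup_left) (ih _ ?_ (hc.trans le_sup_left))
        · rw [eq_top_iff]
          rintro y -
          obtain ⟨⟨_, t, rfl⟩, rfl⟩ := Submodule.mkQ_surjective _ y
          refine Submodule.mem_span_singleton.2 ⟨t, ?_⟩
          rw [← map_smul]
          congr 1
          ext
          change t • f 1 = f t
          rw [← map_smul, smul_eq_mul, mul_one]
        · intro s hs
          obtain ⟨a, ha, b, hb, rfl⟩ := Submodule.mem_sup.1 hs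
          obtain ⟨t, rfl⟩ := Ideal.mem_span_singleton'.1 hb
          rw [add_smul, ← map_smul, ← map_smul, hfc a ha, map_zero, zero_add, mul_smul, map_smul]
          convert smul_zero t
          rw [Submodule.mkQ_apply, Submodule.Quotient.mk_eq_zero]
          refine ⟨q, ?_⟩
          ext
          change L.mkQ (r • q) = r • f 1
          simp [f]
        · refine lt_of_le_of_ne le_sup_left fun h => hrc ?_
          rw [h]
          exact Submodule.mem_sup_right (Submodule.mem_span_singleton_self r)
      refine quot (LinearMap.range f) (R ⧸ c)
        ((Submodule.quotEquivOfEq _ _ hker).toLinearMap ∘ₗ f.quotKerEquivRange.symm.toLinearMap)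
        ?_ hann hPV
      exact (Submodule.quotEquivOfEq _ _ hker).surjective.comp f.quotKerEquivRange.symm.surjective
    · by_cases ht : c = ⊤
      · have : Subsingleton (R ⧸ c) := Ideal.Quotient.subsingleton_iff.2 ht
        exact quot M _ 0 (fun y => ⟨0, Subsingleton.elim _ _⟩) le_rfl hM
      · obtain ⟨a, ha, b, hb, hab⟩ : ∃ a, a ∉ c ∧ ∃ b, b ∉ c ∧ a * b ∈ c := by
          by_contra! h
          refine hp ⟨ht, fun {x y} hxy => ?_⟩
          by_contra! hn
          exact h x hn.1 y hn.2 hxy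
        have hlt (x : R) (hx : x ∉ c) : c < c ⊔ Ideal.span {x} := by
          refine lt_of_le_of_ne le_sup_left fun h => hx ?_
          rw [h]
          exact Submodule.mem_sup_right (Submodule.mem_span_singleton_self x)
        have hcR : ∀ s ∈ c, ∀ y : R ⧸ c, s • y = 0 := by
          intro s hs y
          obtain ⟨t, rfl⟩ := Ideal.Quotient.mk_surjective y
          exact Ideal.Quotient.eq_zero_iff_mem.2 (c.mul_mem_right _ hs)
        -- As ab ∈ c, the submodule generated by a is a quotient of R/(c + (b)), and the cokernel is
        -- one of R/(c + (a)).
        refine ext _ (Submodule.span R {(Ideal.Quotient.mk c a : R ⧸ c)}) ?_ ?_ ?_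
        · rwa [Ideal.annihilator_quotient]
        · refine ann_quot _ (c ⊔ Ideal.span {b})
            ⟨Ideal.Quotient.mk c a, Submodule.mem_span_singleton_self _⟩ ?_ ?_
            (hc.trans le_sup_left) (ih _ (hlt b hb) (hc.trans le_sup_left))
          · rw [eq_top_iff]
            rintro ⟨y, hy⟩ -
            obtain ⟨t, rfl⟩ := Submodule.mem_span_singleton.1 hy
            exact Submodule.mem_span_singleton.2 ⟨t, rfl⟩
          · intro s hs
            obtain ⟨x, hx, y, hy, rfl⟩ := Submodule.mem_sup.1 hs
            obtain ⟨t, rfl⟩ := Ideal.mem_span_singleton'.1 hy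
            ext
            change (x + t * b) • (Ideal.Quotient.mk c a : R ⧸ c) = 0
            rw [add_smul, hcR x hx, zero_add]
            refine Ideal.Quotient.eq_zero_iff_mem.2 ?_
            change t * b * a ∈ c
            rw [mul_assoc, mul_comm b]
            exact c.mul_mem_left _ hab
        · refine ann_quot _ (c ⊔ Ideal.span {a}) (Submodule.mkQ _ (Ideal.Quotient.mk c 1)) ?_ ?_
            (hc.trans le_sup_left) (ih _ (hlt a ha) (hc.trans le_sup_left))
          · rw [eq_top_iff]
            rintro y -
            obtain ⟨y, rfl⟩ := Submodule.mkQ_surjective _ y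
            obtain ⟨t, rfl⟩ := Ideal.Quotient.mk_surjective y
            refine Submodule.mem_span_singleton.2 ⟨t, ?_⟩
            rw [← map_smul]
            congr 1
            change Ideal.Quotient.mk c (t * 1) = _
            rw [mul_one]
          · intro s hs
            obtain ⟨x, hx, y, hy, rfl⟩ := Submodule.mem_sup.1 hs
            obtain ⟨t, rfl⟩ := Ideal.mem_span_singleton'.1 hy
            rw [add_smul, ← map_smul, hcR x hx, map_zero, zero_add, ← map_smul,
              Submodule.mkQ_apply, Submodule.Quotient.mk_eq_zero]
            refine Submodule.mem_span_singleton.2 ⟨t, ?_⟩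
            change Ideal.Quotient.mk c (t * a) = Ideal.Quotient.mk c (t * a * 1)
            rw [mul_one]
  have sub (K : Submodule R X) : P K := by
    have hK (K : Submodule R X) : Module.annihilator R M ≤ Module.annihilator R K :=
      hX.trans (LinearMap.annihilator_le_of_injective K.subtype K.subtype_injective)
    induction K, IsNoetherian.noetherian K using Submodule.fg_induction with
    | singleton x =>
      refine ann_quot _ (Module.annihilator R M) ⟨x, Submodule.mem_span_singleton_self x⟩ ?_ ?_
        le_rfl (cyc _ le_rfl)
      · rw [eq_top_iff]
        rintro ⟨y, hy⟩ -
        obtain ⟨t, rfl⟩ := Submodule.mem_span_singleton.1 hy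
        exact Submodule.mem_span_singleton.2 ⟨t, rfl⟩
      · intro r hr
        ext
        exact Module.mem_annihilator.1 (hX hr) x
    | sup K₁ K₂ _ _ h₁ h₂ =>
      have e := (Submodule.comapSubtypeEquivOfLe (le_sup_left : K₁ ≤ K₁ ⊔ K₂))
      refine ext _ (Submodule.comap (K₁ ⊔ K₂).subtype K₁) (hK _)
        (quot K₁ _ e.symm.toLinearMap e.symm.surjective (hK _) h₁) ?_
      refine quot K₂ _ (Submodule.mkQ _ ∘ₗ Submodule.inclusion le_sup_right) ?_ (hK _) h₂
      intro y
      obtain ⟨⟨y, hy⟩, rfl⟩ := Submodule.mkQ_surjective _ y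
      obtain ⟨a, ha, b, hb, rfl⟩ := Submodule.mem_sup.1 hy
      refine ⟨⟨b, hb⟩, ?_⟩
      rw [LinearMap.comp_apply, ← sub_eq_zero, ← map_sub, Submodule.mkQ_apply,
        Submodule.Quotient.mk_eq_zero, Submodule.mem_comap]
      simpa using ha
  exact quot (⊤ : Submodule R X) X Submodule.topEquiv.toLinearMap Submodule.topEquiv.surjective
    (hX.trans (LinearMap.annihilator_le_of_injective _ (Submodule.subtype_injective _))) (sub ⊤)

end ModuleInduction

/-! ### Artinian modules and their sum-irreducible summands. -/

section Artinian

variable {R : Type u} [CommRing R]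

/-- The descending chain condition on submodules of N, phrased for modules. Invariance under
isomorphism identifies submodules of L ≤ N with submodules of N. -/
theorem artinian_module_induction (P : ∀ (N : Type u) [AddCommGroup N] [Module R N], Prop)
    (iso : ∀ (N N' : Type u) [AddCommGroup N] [Module R N] [AddCommGroup N'] [Module R N']
      (_ : N ≃ₗ[R] N'), P N → P N')
    (step : ∀ (N : Type u) [AddCommGroup N] [Module R N] [IsArtinian R N],
      (∀ K : Submodule R N, K ≠ ⊤ → P K) → P N)
    (N : Type u) [AddCommGroup N] [Module R N] [IsArtinian R N] : P N := by
  have key (L : Submodule R N) : P L := by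
    refine IsArtinian.induction (P := fun L : Submodule R N => P L) (fun L ih => ?_) L
    refine step L fun K hK => ?_
    refine iso _ _ (K.equivMapOfInjective L.subtype L.subtype_injective).symm
      (ih (K.map L.subtype) ?_)
    refine lt_of_le_of_ne (Submodule.map_subtype_le L K) fun h => hK ?_
    rw [eq_top_iff]
    rintro ⟨x, hx⟩ -
    obtain ⟨y, hy, hyx⟩ := h.ge hx
    rwa [show (⟨x, hx⟩ : L) = y from Subtype.ext hyx.symm]
  exact iso _ _ Submodule.topEquiv (key ⊤)

variable (N : Type u) [AddCommGroup N] [Module R N]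

/-- For a sum-irreducible Artinian module every scalar is surjective or nilpotent. -/
lemma _root_.SupIrred.surjective_or_nilpotent [IsArtinian R N] {S : Submodule R N}
    (hS : SupIrred S) (x : R) : (∀ s ∈ S, ∃ t ∈ S, x • t = s) ∨ ∃ n : ℕ, ∀ s ∈ S, x ^ n • s = 0 := by
  -- Fitting: S = ker xⁿ + im xⁿ for large n. Taking n ≥ 1 makes im xⁿ lie in x S.
  obtain ⟨n, hn0, hn⟩ := (((LinearMap.lsmul R S x :
    Module.End R S).eventually_codisjoint_ker_pow_range_pow).and
    (Filter.eventually_ge_atTop 1)).exists.imp fun n h => And.symm h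
  have hpow (s : S) : ((LinearMap.lsmul R S x : Module.End R S) ^ n) s = x ^ n • s := by
    rw [Module.End.pow_apply]
    exact smul_iterate_apply x n s
  have hsup := congrArg (Submodule.map S.subtype) (codisjoint_iff.1 hn)
  rw [Submodule.map_sup, Submodule.map_subtype_top] at hsup
  rcases hS.2 hsup with h | h
  · right
    refine ⟨n, fun s hs => ?_⟩
    rw [← h] at hs
    obtain ⟨y, hy, rfl⟩ := hs
    have := hpow y
    rw [LinearMap.mem_ker.1 hy] at this
    exact congrArg Subtype.val this.symm
  · left
    intro s hs
    rw [← h] at hs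
    obtain ⟨_, ⟨z, rfl⟩, rfl⟩ := hs
    obtain ⟨k, rfl⟩ := Nat.exists_eq_add_of_le' hn0
    refine ⟨x ^ k • z, S.smul_mem _ z.2, ?_⟩
    rw [hpow, smul_smul, ← pow_succ']
    rfl

/-- An Artinian module `N` with `I N = N` admits an element of `I` acting surjectively. -/
theorem exists_surjective_smul [IsNoetherianRing R] [IsArtinian R N] (I : Ideal R) (h : I • (⊤ : Submodule R N) = ⊤) :
    ∃ x ∈ I, Function.Surjective fun y : N => x • y := by
  classical
  -- A decomposition with the fewest sum-irreducible summands is irredundant.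
  have hex : ∃ k : ℕ, ∃ s : Finset (Submodule R N), s.card = k ∧ s.sup id = ⊤ ∧
      ∀ b ∈ s, SupIrred b := by
    obtain ⟨s, hs, hb⟩ := exists_supIrred_decomposition (⊤ : Submodule R N)
    exact ⟨_, s, rfl, hs, fun b h => hb h⟩
  obtain ⟨s, hcard, hsup, hirr⟩ := Nat.find_spec hex
  have hmin (S : Submodule R N) (hS : S ∈ s) : (s.erase S).sup id ≠ ⊤ := by
    intro h'
    refine Nat.find_min hex (m := (s.erase S).card) ?_
      ⟨s.erase S, rfl, h', fun b hb => hirr b (Finset.mem_of_mem_erase hb)⟩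
    rw [← hcard]
    exact Finset.card_erase_lt_of_mem hS
  by_cases hI : ∃ x ∈ I, ∀ S ∈ s, ¬ ∃ n : ℕ, ∀ y ∈ S, x ^ n • y = 0
  · obtain ⟨x, hx, hxs⟩ := hI
    refine ⟨x, hx, ?_⟩
    change Function.Surjective (LinearMap.lsmul R N x)
    rw [← LinearMap.range_eq_top, eq_top_iff, ← hsup, Finset.sup_le_iff]
    intro S hS y hy
    rcases (hirr S hS).surjective_or_nilpotent N x with h1 | h1
    · obtain ⟨t, -, ht⟩ := h1 y hy
      exact ⟨t, ht⟩
    · exact absurd h1 (hxs S hS)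
  · exfalso
    push Not at hI
    -- Otherwise each x ∈ I is nilpotent on some summand S. The radicals of the Ann S are prime, so
    -- prime avoidance puts I inside one of them.
    have hcover : (I : Set R) ⊆ ⋃ S ∈ (s : Set (Submodule R N)),
        ((Module.annihilator R S).radical : Ideal R) := by
      intro x hx
      obtain ⟨S, hS, n, hn⟩ := hI x hx
      simp only [Set.mem_iUnion]
      exact ⟨S, hS, n, Module.mem_annihilator.2 fun y => Subtype.ext (hn y y.2)⟩
    have hprime : ∀ S ∈ s, (Module.annihilator R S).radical.IsPrime := by
      intro S hS
      have hsurj {x : R} (hx : x ∉ (Module.annihilator R S).radical) :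
          Function.Surjective fun y : S => x • y := by
        rcases (hirr S hS).surjective_or_nilpotent N x with h1 | ⟨n, hn⟩
        · rintro ⟨y, hy⟩
          obtain ⟨t, ht, rfl⟩ := h1 y hy
          exact ⟨⟨t, ht⟩, rfl⟩
        · exact absurd ⟨n, Module.mem_annihilator.2 fun y => Subtype.ext (hn y y.2)⟩ hx
      refine ⟨?_, fun {x y} hxy => ?_⟩
      · rw [Ne, Ideal.radical_eq_top, Module.annihilator_eq_top_iff, not_subsingleton_iff_nontrivial,
          Submodule.nontrivial_iff_ne_bot]
        exact (hirr S hS).ne_bot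
      · by_contra! hn
        obtain ⟨n, hn'⟩ := hxy
        have h2 : Function.Surjective fun z : S => (x * y) ^ n • z := by
          have : (fun z : S => (x * y) ^ n • z) = (fun z : S => (x * y) • z)^[n] := by
            funext z
            exact (smul_iterate_apply _ _ _).symm
          rw [this]
          refine Function.Surjective.iterate ?_ n
          have : (fun z : S => (x * y) • z) = (fun z : S => x • z) ∘ (fun z : S => y • z) := by
            funext z
            exact mul_smul _ _ _
          rw [this]
          exact (hsurj hn.1).comp (hsurj hn.2)
        refine (hirr S hS).ne_bot ((Submodule.eq_bot_iff _).2 fun z hz => ?_)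
        obtain ⟨w, hw⟩ := h2 ⟨z, hz⟩
        exact congrArg Subtype.val (hw.symm.trans (Module.mem_annihilator.1 hn' w))
    obtain ⟨S, hS, hIS⟩ := (Ideal.subset_union_prime (s := s) ⊥ ⊥
      (fun S hS _ _ => hprime S hS)).1 hcover
    -- `I` acts nilpotently on `S`, hence on the nonzero quotient of `N` by the other summands
    obtain ⟨k, hk⟩ := Ideal.exists_pow_le_of_le_radical_of_fg hIS (IsNoetherian.noetherian I)
    have hIk : I ^ k • (⊤ : Submodule R N) = ⊤ := by
      clear hk
      induction k with
      | zero => simp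
      | succ k ih => rw [pow_succ, mul_smul, h, ih]
    refine hmin S hS (eq_top_iff.2 ?_)
    calc (⊤ : Submodule R N) = I ^ k • (S ⊔ (s.erase S).sup id) := by
          rw [← hIk, ← hsup, ← Finset.insert_erase hS, Finset.sup_insert,
            Finset.erase_insert (Finset.notMem_erase S s)]
          rfl
      _ ≤ (s.erase S).sup id := by
          rw [Submodule.smul_sup, sup_le_iff]
          refine ⟨Submodule.smul_le.2 fun r hr y hy => ?_, Submodule.smul_le_right⟩
          rw [show r • y = 0 from
            congrArg Subtype.val (Module.mem_annihilator.1 (hk hr) (⟨y, hy⟩ : S))]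
          exact Submodule.zero_mem _

/-- The submodule annihilated by a power of `I` is Noetherian when the one annihilated by `I` is. -/
lemma isNoetherian_torsionBySet_pow [IsNoetherianRing R] (I : Ideal R)
    [IsNoetherian R (Submodule.torsionBySet R N I)] (k : ℕ) :
    IsNoetherian R (Submodule.torsionBySet R N (I ^ k : Ideal R)) := by
  induction k with
  | zero =>
    have : Subsingleton (Submodule.torsionBySet R N (I ^ 0 : Ideal R)) := by
      refine ⟨fun x y => Subtype.ext ?_⟩
      have h (z : Submodule.torsionBySet R N (I ^ 0 : Ideal R)) : (z : N) = 0 := by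
        have := (Submodule.mem_torsionBySet_iff _ _).1 z.2 ⟨1, by simp⟩
        simpa using this
      rw [h, h]
    infer_instance
  | succ k ih =>
    obtain ⟨s, hs⟩ := IsNoetherian.noetherian I
    -- Multiplication by finitely many generators of I, with kernel inside (0 :_N I).
    let f : Submodule.torsionBySet R N (I ^ (k + 1) : Ideal R) →ₗ[R]
        (s → Submodule.torsionBySet R N (I ^ k : Ideal R)) :=
      LinearMap.pi fun a => LinearMap.restrict (LinearMap.lsmul R N a) (by
        intro y hy
        rw [Submodule.mem_torsionBySet_iff] at hy ⊢
        rintro ⟨b, hb⟩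
        have := hy ⟨b * a, by
          rw [pow_succ]
          exact Ideal.mul_mem_mul hb (hs ▸ Submodule.subset_span a.2)⟩
        simpa [mul_smul] using this)
    let g : LinearMap.ker f →ₗ[R] Submodule.torsionBySet R N I :=
      LinearMap.codRestrict _ (Submodule.subtype _ ∘ₗ Submodule.subtype _) (by
        rintro ⟨y, hy⟩
        rw [Submodule.mem_torsionBySet_iff]
        rintro ⟨b, hb⟩
        change b • (y : N) = 0
        have hb' : b ∈ Submodule.span R (s : Set R) := hs ▸ hb
        induction hb' using Submodule.span_induction with
        | mem a ha => exact congrArg Subtype.val (congrFun hy ⟨a, ha⟩)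
        | zero => exact zero_smul _ _
        | add a b ha hb' h1 h2 =>
          rw [add_smul, h1 (hs.le ha), h2 (hs.le hb'), add_zero]
        | smul c a ha h1 => rw [smul_assoc, h1 (hs.le ha), smul_zero])
    have hg : Function.Injective g := by
      intro y z h
      exact Subtype.ext (Subtype.ext (congrArg (fun w : Submodule.torsionBySet R N I => (w : N)) h))
    have := isNoetherian_of_injective g hg
    have := isNoetherian_of_injective f.rangeRestrict
    exact isNoetherian_of_range_eq_ker (LinearMap.ker f).subtype f (by simp)

end Artinian

/-! ### Mittag-Leffler lifting for Artinian inverse systems. -/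

section InverseLimit

variable {R : Type*} [CommRing R] {A B : ℕ → Type*} [∀ n, AddCommGroup (A n)]
  [∀ n, Module R (A n)] [∀ n, AddCommGroup (B n)] [∀ n, Module R (B n)]

/-- Inverse limits of sequences of Artinian modules are exact: a compatible family of elements that
are liftable one by one has a compatible family of lifts. -/
theorem exists_compatible_lift [∀ n, IsArtinian R (A n)]
    (t : ∀ ⦃m n : ℕ⦄, m ≤ n → A n →ₗ[R] A m)
    (ht_self : ∀ n (x : A n), t le_rfl x = x)
    (ht : ∀ ⦃l m n : ℕ⦄ (h₁ : l ≤ m) (h₂ : m ≤ n) (x : A n), t h₁ (t h₂ x) = t (h₁.trans h₂) x)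
    (s : ∀ ⦃m n : ℕ⦄, m ≤ n → B n →ₗ[R] B m) (f : ∀ n, A n →ₗ[R] B n)
    (hf : ∀ ⦃m n : ℕ⦄ (h : m ≤ n) (x : A n), f m (t h x) = s h (f n x))
    (b : ∀ n, B n) (hb : ∀ ⦃m n : ℕ⦄ (h : m ≤ n), s h (b n) = b m)
    (hlift : ∀ n, ∃ a, f n a = b n) :
    ∃ a : ∀ n, A n, (∀ ⦃m n : ℕ⦄ (h : m ≤ n), t h (a n) = a m) ∧ ∀ n, f n (a n) = b n := by
  -- The lifts at level n that come from lifts at every later level; only these can belong to a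
  -- compatible family.
  let stable (n : ℕ) (a : A n) : Prop := ∀ m (h : n ≤ m), ∃ c, f m c = b m ∧ t h c = a
  have key (n : ℕ) : ∃ m, ∃ h : n ≤ m, ∀ c, f m c = b m → stable n (t h c) := by
    -- The images in `A n` of the later kernels decrease, hence stabilise.
    let D : ℕ →o (Submodule R (A n))ᵒᵈ :=
      ⟨fun k => OrderDual.toDual ((LinearMap.ker (f (n + k))).map (t (Nat.le_add_right n k))), by
        rintro k l hkl _ ⟨x, hx, rfl⟩
        refine ⟨t (Nat.add_le_add_left hkl n) x, ?_, ht _ _ _⟩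
        rw [SetLike.mem_coe, LinearMap.mem_ker, hf, LinearMap.mem_ker.1 hx, map_zero]⟩
    obtain ⟨k, hk⟩ := IsArtinian.monotone_stabilizes D
    refine ⟨n + k, Nat.le_add_right n k, fun c hc m hm => ?_⟩
    rcases le_total m (n + k) with h | h
    · exact ⟨t h c, by rw [hf, hc, hb], ht _ _ _⟩
    · obtain ⟨l, rfl⟩ := Nat.exists_eq_add_of_le hm
      obtain ⟨d, hd⟩ := hlift (n + l)
      -- Two lifts differ by a kernel element. By stabilisation its image comes from a kernel
      -- element at level n + l, and adding that to d gives a lift with the same image as c.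
      have hmem : t (Nat.le_add_right n k) (c - t h d) ∈ OrderDual.ofDual (D l) := by
        rw [← hk l (by omega)]
        refine ⟨_, ?_, rfl⟩
        rw [SetLike.mem_coe, LinearMap.mem_ker, map_sub, hf, hd, hb, hc, sub_self]
      obtain ⟨κ, hκ, hκ'⟩ := hmem
      refine ⟨d + κ, by rw [map_add, hd, LinearMap.mem_ker.1 hκ, add_zero], ?_⟩
      rw [map_add, hκ', map_sub, ht, add_sub_cancel]
  have h0 : ∃ a, stable 0 a := by
    obtain ⟨m, h, hm⟩ := key 0
    obtain ⟨c, hc⟩ := hlift m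
    exact ⟨_, hm c hc⟩
  have hsucc (n : ℕ) (a : A n) (ha : stable n a) :
      ∃ a', stable (n + 1) a' ∧ t n.le_succ a' = a := by
    obtain ⟨m, h, hm⟩ := key (n + 1)
    obtain ⟨c, hc, rfl⟩ := ha m (n.le_succ.trans h)
    exact ⟨_, hm c hc, ht _ _ _⟩
  choose g hg hg' using hsucc
  obtain ⟨a₀, ha₀⟩ := h0
  let a (n : ℕ) : {a : A n // stable n a} :=
    Nat.rec ⟨a₀, ha₀⟩ (fun n x => ⟨g n x.1 x.2, hg n x.1 x.2⟩) n
  refine ⟨fun n => (a n).1, fun m n h => ?_, fun n => ?_⟩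
  · induction n, h using Nat.le_induction with
    | base => exact ht_self _ _
    | succ n h ih =>
      rw [← ih, ← ht h n.le_succ]
      congr 1
      exact hg' n _ _
  · obtain ⟨c, hc, hc'⟩ := (a n).2 n le_rfl
    change f n (a n).1 = b n
    rw [← hc', ht_self, hc]

end InverseLimit

/-! ### The adic completion of a Noetherian ring is Noetherian. -/

section Completion

variable {R : Type*} [CommRing R]

/-- A surjection `P → R` carrying `J` onto `I` induces a surjection of adic completions. -/
lemma exists_surjective_adicCompletion {P : Type*} [CommRing P] (J : Ideal P) (I : Ideal R)
    (φ : P →+* R) (hφ : Function.Surjective φ) (hJ : J.map φ = I) :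
    ∃ ψ : AdicCompletion J P →+* AdicCompletion I R, Function.Surjective ψ := by
  have hpow (n : ℕ) : (J ^ n).map φ = I ^ n := by rw [Ideal.map_pow, hJ]
  let q (n : ℕ) : P ⧸ J ^ n →+* R ⧸ I ^ n :=
    Ideal.quotientMap (I ^ n) φ (Ideal.map_le_iff_le_comap.1 (hpow n).le)
  let ψ : AdicCompletion J P →+* AdicCompletion I R :=
    AdicCompletion.liftRingHom I (fun n => (q n).comp (AdicCompletion.evalₐ J n).toRingHom) (by
      intro m n h
      ext x
      obtain ⟨p, rfl⟩ := AdicCompletion.mk_surjective J P x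
      simp only [RingHom.comp_apply, AlgHom.toRingHom_eq_coe, RingHom.coe_coe]
      rw [AdicCompletion.evalₐ_mk, AdicCompletion.evalₐ_mk, ← AdicCompletion.Ideal.mk_eq_mk J h]
      rfl)
  refine ⟨ψ, fun x => ?_⟩
  obtain ⟨r, rfl⟩ := AdicCompletion.mk_surjective I R x
  -- Lifting the successive differences into Jⁿ makes the partial sums of the lifts a J-adic Cauchy
  -- sequence over r.
  have hr (n : ℕ) : ∃ d ∈ J ^ n, φ d = r (n + 1) - r n := by
    rw [← Ideal.mem_map_iff_of_surjective φ hφ, hpow]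
    have := SModEq.sub_mem.1 (r.2 n.le_succ).symm
    rwa [smul_eq_mul, Ideal.mul_top] at this
  choose d hd hdr using hr
  obtain ⟨c, hc⟩ := hφ (r 0)
  let p (n : ℕ) : P := c + ∑ k ∈ Finset.range n, d k
  have hp (n : ℕ) : φ (p n) = r n := by
    induction n with
    | zero => simpa [p] using hc
    | succ n ih =>
      have : p (n + 1) = p n + d n := by simp only [p, Finset.sum_range_succ, add_assoc]
      rw [this, map_add, ih, hdr, add_sub_cancel]
  refine ⟨AdicCompletion.mk J P (AdicCompletion.AdicCauchySequence.mk J P p fun n => ?_), ?_⟩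
  · refine (SModEq.sub_mem.2 ?_).symm
    simp only [p, Finset.sum_range_succ, ← add_assoc, add_sub_cancel_left]
    rw [smul_eq_mul, Ideal.mul_top]
    exact hd n
  · refine AdicCompletion.ext_evalₐ fun n => ?_
    rw [AdicCompletion.evalₐ_liftRingHom]
    simp only [RingHom.comp_apply, AlgHom.toRingHom_eq_coe, RingHom.coe_coe]
    rw [AdicCompletion.evalₐ_mk, AdicCompletion.evalₐ_mk]
    change Ideal.Quotient.mk (I ^ n) (φ (p n)) = _
    rw [hp]

/-- Sending variables to generators of I makes the completion a quotient of a power series ring in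
finitely many variables over R. -/
instance isNoetherianRing_adicCompletion [IsNoetherianRing R] (I : Ideal R) :
    IsNoetherianRing (AdicCompletion I R) := by
  obtain ⟨s, hs⟩ := IsNoetherian.noetherian I
  let φ : MvPolynomial s R →+* R := (MvPolynomial.aeval (R := R) (fun a : s => (a : R))).toRingHom
  obtain ⟨ψ, hψ⟩ := exists_surjective_adicCompletion (MvPolynomial.idealOfVars s R) I φ
    (fun r => ⟨MvPolynomial.C r, by simp [φ]⟩) (by
      rw [MvPolynomial.idealOfVars, Ideal.map_span, ← Set.range_comp, ← hs]
      congr 1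
      ext x
      simp [φ])
  have : IsNoetherianRing (AdicCompletion (MvPolynomial.idealOfVars s R) (MvPolynomial s R)) :=
    isNoetherianRing_of_ringEquiv _ (MvPowerSeries.toAdicCompletionAlgEquiv s R).toRingEquiv
  exact isNoetherianRing_of_surjective _ _ ψ hψ

end Completion

/-! ### The long exact sequence of Tor in the first variable. -/

section TorLES

open CategoryTheory.MonoidalCategory

variable {R : Type u} [CommRing R]

/-- The complex `X ⊗ P`, for the chosen projective resolution `P` of `N`, as a functor of `X`. -/
def torComplex (N : ModuleCat.{u} R) : ModuleCat.{u} R ⥤ ChainComplex (ModuleCat.{u} R) ℕ where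
  obj X := (((tensoringLeft (ModuleCat.{u} R)).obj X).mapHomologicalComplex _).obj
    (projectiveResolution N).complex
  map f := (NatTrans.mapHomologicalComplex ((tensoringLeft (ModuleCat.{u} R)).map f) _).app
    (projectiveResolution N).complex
  map_id X := by
    ext i : 1
    exact id_whiskerRight _ _
  map_comp f g := by
    ext i : 1
    exact comp_whiskerRight _ _ _

/-- `Tor_i(X, N)` is the homology of `X ⊗ P`. -/
def torIso (X N : ModuleCat.{u} R) (i : ℕ) :
    ((Tor (ModuleCat.{u} R) i).obj X).obj N ≅ ((torComplex N).obj X).homology i :=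
  (projectiveResolution N).isoLeftDerivedObj _ i

lemma tor_map_app_eq {X Y : ModuleCat.{u} R} (f : X ⟶ Y) (N : ModuleCat.{u} R) (i : ℕ) :
    ((Tor (ModuleCat.{u} R) i).map f).app N =
      (torIso X N i).hom ≫ HomologicalComplex.homologyMap ((torComplex N).map f) i ≫
        (torIso Y N i).inv :=
  ProjectiveResolution.leftDerived_app_eq _ _ i

instance (N : ModuleCat.{u} R) : (torComplex N).PreservesZeroMorphisms where
  map_zero X Y := by
    ext i : 1
    exact MonoidalPreadditive.zero_whiskerRight

/-- The terms of the resolution of N are flat. Hence one resolution yields long exact sequences in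
X, although Tor is derived in the other variable. -/
lemma torComplex_map_shortExact (N : ModuleCat.{u} R) {S : ShortComplex (ModuleCat.{u} R)}
    (hS : S.ShortExact) : (S.map (torComplex N)).ShortExact := by
  refine HomologicalComplex.shortExact_of_degreewise_shortExact _ fun i => ?_
  have : Module.Projective R ((projectiveResolution N).complex.X i) := inferInstance
  have hex := (ShortComplex.ShortExact.moduleCat_exact_iff_function_exact S).1 hS.exact
  refine { exact := (ShortComplex.ShortExact.moduleCat_exact_iff_function_exact _).2 ?_
           mono_f := (ModuleCat.mono_iff_injective _).2 ?_
           epi_g := (ModuleCat.epi_iff_surjective _).2 ?_ }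
  · exact Module.Flat.rTensor_exact ((projectiveResolution N).complex.X i) hex
  · exact Module.Flat.rTensor_preserves_injective_linearMap
      (M := (projectiveResolution N).complex.X i) _ hS.moduleCat_injective_f
  · exact LinearMap.rTensor_surjective ((projectiveResolution N).complex.X i)
      hS.moduleCat_surjective_g

variable {X X' X'' : Type u} [AddCommGroup X] [Module R X] [AddCommGroup X'] [Module R X']
  [AddCommGroup X''] [Module R X'']

/-- `Tor_i(X, N)` is the homology of `X ⊗ P`. -/
def torEquiv (X N : Type u) [AddCommGroup X] [Module R X] [AddCommGroup N] [Module R N] (i : ℕ) :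
    TorMod R X N i ≃ₗ[R] ((torComplex (ModuleCat.of R N)).obj (ModuleCat.of R X)).homology i :=
  (torIso (ModuleCat.of R X) (ModuleCat.of R N) i).toLinearEquiv

variable (f : X' →ₗ[R] X) (g : X →ₗ[R] X'') (N : Type u) [AddCommGroup N] [Module R N] (i : ℕ)

/-- The map induced by `f` on the homology of `X ⊗ P`. -/
def torHomologyMap : ((torComplex (ModuleCat.of R N)).obj (ModuleCat.of R X')).homology i →ₗ[R]
    ((torComplex (ModuleCat.of R N)).obj (ModuleCat.of R X)).homology i :=
  (HomologicalComplex.homologyMap ((torComplex (ModuleCat.of R N)).map (ModuleCat.ofHom f)) i).hom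

lemma torMap_eq (y : TorMod R X' N i) :
    torMap f N i y = (torEquiv X N i).symm (torHomologyMap f N i (torEquiv X' N i y)) :=
  congrArg (fun φ => φ.hom y) (tor_map_app_eq (ModuleCat.ofHom f) (ModuleCat.of R N) i)

lemma torEquiv_torMap (y : TorMod R X' N i) :
    torEquiv X N i (torMap f N i y) = torHomologyMap f N i (torEquiv X' N i y) := by
  rw [torMap_eq, LinearEquiv.apply_symm_apply]

lemma torMap_id (y : TorMod R X N i) : torMap (LinearMap.id : X →ₗ[R] X) N i y = y :=
  congrArg (fun φ => φ.hom y) (congrArg (fun φ => NatTrans.app φ (ModuleCat.of R N))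
    ((Tor (ModuleCat.{u} R) i).map_id (ModuleCat.of R X)))

lemma torMap_torMap (y : TorMod R X' N i) :
    torMap g N i (torMap f N i y) = torMap (g ∘ₗ f) N i y :=
  (congrArg (fun φ => φ.hom y) (congrArg (fun φ => NatTrans.app φ (ModuleCat.of R N))
    ((Tor (ModuleCat.{u} R) i).map_comp (ModuleCat.ofHom f) (ModuleCat.ofHom g)))).symm

/-- A linear equivalence induces an equivalence on `Tor`. -/
def torCongr (e : X' ≃ₗ[R] X) : TorMod R X' N i ≃ₗ[R] TorMod R X N i :=
  LinearEquiv.ofLinearMap (torMap e.toLinearMap N i) (torMap e.symm.toLinearMap N i)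
    (by ext y; simp [torMap_torMap, torMap_id]) (by ext y; simp [torMap_torMap, torMap_id])

lemma rTensor_lsmul_apply (Q : Type u) [AddCommGroup Q] [Module R Q] (r : R)
    (w : TensorProduct R X Q) : LinearMap.rTensor Q (LinearMap.lsmul R X r) w = r • w := by
  induction w using TensorProduct.induction_on with
  | zero => simp
  | tmul a b => rw [LinearMap.rTensor_tmul, LinearMap.lsmul_apply, TensorProduct.smul_tmul']
  | add a b ha hb => rw [map_add, smul_add, ha, hb]

/-- Multiplication by `r` on `X` induces multiplication by `r` on `Tor_i(X, N)`. -/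
lemma torMap_lsmul (r : R) (y : TorMod R X N i) :
    torMap (LinearMap.lsmul R X r) N i y = r • y := by
  apply (torEquiv X N i).injective
  rw [torEquiv_torMap, map_smul]
  generalize torEquiv X N i y = z
  let C := (torComplex (ModuleCat.of R N)).obj (ModuleCat.of R X)
  let φ : C ⟶ C := (torComplex (ModuleCat.of R N)).map (ModuleCat.ofHom (LinearMap.lsmul R X r))
  change HomologicalComplex.homologyMap φ i z = r • z
  obtain ⟨z, rfl⟩ := (ModuleCat.epi_iff_surjective (C.homologyπ i)).1 inferInstance z
  refine (congrArg (fun ψ => ψ.hom z) (HomologicalComplex.homologyπ_naturality φ i)).trans ?_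
  rw [← map_smul]
  refine congrArg (C.homologyπ i).hom ?_
  apply (ModuleCat.mono_iff_injective (C.iCycles i)).1 inferInstance
  refine (congrArg (fun ψ => ψ.hom z) (HomologicalComplex.cyclesMap_i φ i)).trans ?_
  rw [map_smul]
  exact rTensor_lsmul_apply _ r (C.iCycles i z)

section

variable {f g} (hf : Function.Injective f) (hfg : Function.Exact f g) (hg : Function.Surjective g)

/-- A short exact sequence of modules as a short complex. -/
abbrev seqOfExact : ShortComplex (ModuleCat.{u} R) :=
  ShortComplex.mk (ModuleCat.ofHom f) (ModuleCat.ofHom g) (by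
    ext x
    exact hfg.apply_apply_eq_zero x)

include hf hg in
lemma seqOfExact_shortExact : (seqOfExact hfg).ShortExact where
  exact := (ShortComplex.ShortExact.moduleCat_exact_iff_function_exact _).2 hfg
  mono_f := (ModuleCat.mono_iff_injective _).2 hf
  epi_g := (ModuleCat.epi_iff_surjective _).2 hg

/-- The connecting map on the homology of `X ⊗ P`. -/
def torHomologyDelta :
    ((torComplex (ModuleCat.of R N)).obj (ModuleCat.of R X'')).homology (i + 1) →ₗ[R]
      ((torComplex (ModuleCat.of R N)).obj (ModuleCat.of R X')).homology i :=
  ((torComplex_map_shortExact (ModuleCat.of R N) (seqOfExact_shortExact hf hfg hg)).δ (i + 1) i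
      rfl).hom

/-- The connecting map `Tor_{i+1}(X'', N) → Tor_i(X', N)`. -/
def torDelta : TorMod R X'' N (i + 1) →ₗ[R] TorMod R X' N i :=
  (torEquiv X' N i).symm.toLinearMap ∘ₗ torHomologyDelta N i hf hfg hg ∘ₗ
    (torEquiv X'' N (i + 1)).toLinearMap

lemma torEquiv_torDelta (y : TorMod R X'' N (i + 1)) :
    torEquiv X' N i (torDelta N i hf hfg hg y) =
      torHomologyDelta N i hf hfg hg (torEquiv X'' N (i + 1) y) := by
  simp only [torDelta, LinearMap.comp_apply, LinearEquiv.coe_coe, LinearEquiv.apply_symm_apply]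

include hf hfg hg in
lemma tor_exact : Function.Exact (torMap f N i) (torMap g N i) := by
  have h : Function.Exact (torHomologyMap f N i) (torHomologyMap g N i) :=
    (ShortComplex.ShortExact.moduleCat_exact_iff_function_exact _).1
      ((torComplex_map_shortExact (ModuleCat.of R N)
        (seqOfExact_shortExact hf hfg hg)).homology_exact₂ i)
  refine (Function.Exact.iff_of_ladder_linearEquiv (e₁ := torEquiv X' N i) (e₂ := torEquiv X N i)
    (e₃ := torEquiv X'' N i) ?_ ?_).1 h
  · exact LinearMap.ext fun y => (torEquiv_torMap f N i y).symm
  · exact LinearMap.ext fun y => (torEquiv_torMap g N i y).symm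

lemma torDelta_torMap_exact :
    Function.Exact (torDelta N i hf hfg hg) (torMap f N i) := by
  have h : Function.Exact (torHomologyDelta N i hf hfg hg) (torHomologyMap f N i) :=
    (ShortComplex.ShortExact.moduleCat_exact_iff_function_exact _).1
      ((torComplex_map_shortExact (ModuleCat.of R N)
        (seqOfExact_shortExact hf hfg hg)).homology_exact₁ (i + 1) i rfl)
  refine (Function.Exact.iff_of_ladder_linearEquiv (e₁ := torEquiv X'' N (i + 1))
    (e₂ := torEquiv X' N i) (e₃ := torEquiv X N i) ?_ ?_).1 h
  · exact LinearMap.ext fun y => (torEquiv_torDelta N i hf hfg hg y).symm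
  · exact LinearMap.ext fun y => (torEquiv_torMap f N i y).symm

lemma torMap_torDelta_exact :
    Function.Exact (torMap g N (i + 1)) (torDelta N i hf hfg hg) := by
  have h : Function.Exact (torHomologyMap g N (i + 1)) (torHomologyDelta N i hf hfg hg) :=
    (ShortComplex.ShortExact.moduleCat_exact_iff_function_exact _).1
      ((torComplex_map_shortExact (ModuleCat.of R N)
        (seqOfExact_shortExact hf hfg hg)).homology_exact₃ (i + 1) i rfl)
  refine (Function.Exact.iff_of_ladder_linearEquiv (e₁ := torEquiv X N (i + 1))
    (e₂ := torEquiv X'' N (i + 1)) (e₃ := torEquiv X' N i) ?_ ?_).1 h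
  · exact LinearMap.ext fun y => (torEquiv_torMap g N (i + 1) y).symm
  · exact LinearMap.ext fun y => (torEquiv_torDelta N i hf hfg hg y).symm

/-- This makes connecting maps commute with the transition maps of an inverse system. -/
lemma torDelta_naturality {Y Y' Y'' : Type u} [AddCommGroup Y] [Module R Y] [AddCommGroup Y']
    [Module R Y'] [AddCommGroup Y''] [Module R Y''] {f₁ : Y' →ₗ[R] Y} {g₁ : Y →ₗ[R] Y''}
    (hf₁ : Function.Injective f₁) (hfg₁ : Function.Exact f₁ g₁) (hg₁ : Function.Surjective g₁)
    (a : X' →ₗ[R] Y') (b : X →ₗ[R] Y) (c : X'' →ₗ[R] Y'') (hab : b ∘ₗ f = f₁ ∘ₗ a)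
    (hbc : c ∘ₗ g = g₁ ∘ₗ b) (y : TorMod R X'' N (i + 1)) :
    torMap a N i (torDelta N i hf hfg hg y) =
      torDelta N i hf₁ hfg₁ hg₁ (torMap c N (i + 1) y) := by
  let φ : seqOfExact hfg ⟶ seqOfExact hfg₁ :=
    { τ₁ := ModuleCat.ofHom a
      τ₂ := ModuleCat.ofHom b
      τ₃ := ModuleCat.ofHom c
      comm₁₂ := by
        ext x
        exact congr($hab x).symm
      comm₂₃ := by
        ext x
        exact congr($hbc x).symm }
  have h := HomologicalComplex.HomologySequence.δ_naturality
    ((torComplex (ModuleCat.of R N)).mapShortComplex.map φ)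
    (torComplex_map_shortExact (ModuleCat.of R N) (seqOfExact_shortExact hf hfg hg))
    (torComplex_map_shortExact (ModuleCat.of R N) (seqOfExact_shortExact hf₁ hfg₁ hg₁))
    (i + 1) i rfl
  apply (torEquiv Y' N i).injective
  rw [torEquiv_torMap, torEquiv_torDelta, torEquiv_torDelta, torEquiv_torMap]
  exact congrArg (fun ψ => ψ.hom (torEquiv X'' N (i + 1) y)) h

end

/-- The isomorphism `Tor_0(X, N) ≃ X ⊗ N`. -/
def torZeroEquiv (X N : Type u) [AddCommGroup X] [Module R X] [AddCommGroup N] [Module R N] :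
    TorMod R X N 0 ≃ₗ[R] TensorProduct R X N :=
  (((tensoringLeft (ModuleCat.{u} R)).obj (ModuleCat.of R X)).leftDerivedZeroIsoSelf.app
    (ModuleCat.of R N)).toLinearEquiv

lemma leftDerived_zero_comp_fromLeftDerivedZero {C : Type*} [Category* C] {D : Type*} [Category* D]
    [Abelian C] [HasProjectiveResolutions C] [Abelian D] {F G : C ⥤ D} [F.Additive] [G.Additive]
    (α : F ⟶ G) (Y : C) :
    (NatTrans.leftDerived α 0).app Y ≫ G.fromLeftDerivedZero.app Y =
      F.fromLeftDerivedZero.app Y ≫ α.app Y := by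
  let P := projectiveResolution Y
  have h : HomologicalComplex.opcyclesMap ((NatTrans.mapHomologicalComplex α _).app P.complex) 0 ≫
      P.fromLeftDerivedZero' G = P.fromLeftDerivedZero' F ≫ α.app Y := by
    rw [← cancel_epi (HomologicalComplex.pOpcycles _ _), HomologicalComplex.p_opcyclesMap_assoc,
      ProjectiveResolution.pOpcycles_comp_fromLeftDerivedZero',
      ProjectiveResolution.pOpcycles_comp_fromLeftDerivedZero'_assoc]
    exact (α.naturality _).symm
  have key : HomologicalComplex.homologyMap ((NatTrans.mapHomologicalComplex α _).app P.complex) 0 ≫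
      (ChainComplex.isoHomologyι₀ _).hom ≫ P.fromLeftDerivedZero' G =
        (ChainComplex.isoHomologyι₀ _).hom ≫ P.fromLeftDerivedZero' F ≫ α.app Y := by
    rw [← h, ← Iso.inv_comp_eq, ChainComplex.isoHomologyι₀_inv_naturality_assoc,
      Iso.inv_hom_id_assoc]
  rw [P.leftDerived_app_eq, P.fromLeftDerivedZero_eq, P.fromLeftDerivedZero_eq]
  simp only [Category.assoc, Iso.inv_hom_id_assoc]
  refine congrArg ((P.isoLeftDerivedObj F 0).hom ≫ ·) (key.trans ?_)
  exact (Category.assoc _ _ _).symm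

lemma torZeroEquiv_torMap (y : TorMod R X' N 0) :
    torZeroEquiv X N (torMap f N 0 y) = f.rTensor N (torZeroEquiv X' N y) :=
  congrArg (fun ψ => ψ.hom y) (leftDerived_zero_comp_fromLeftDerivedZero
    ((tensoringLeft (ModuleCat.{u} R)).map (ModuleCat.ofHom f)) (ModuleCat.of R N))

/-- Higher `Tor` vanishes on flat modules. -/
lemma subsingleton_tor_of_flat (X N : Type u) [AddCommGroup X] [Module R X] [AddCommGroup N]
    [Module R N] [Module.Flat R X] (i : ℕ) : Subsingleton (TorMod R X N (i + 1)) := by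
  let P := projectiveResolution (ModuleCat.of R N)
  have h : ((torComplex (ModuleCat.of R N)).obj (ModuleCat.of R X)).ExactAt (i + 1) := by
    have h1 := (P.complex_exactAt_succ i)
    rw [HomologicalComplex.exactAt_iff' _ (i + 2) (i + 1) i (by simp) (by simp)] at h1 ⊢
    rw [ShortComplex.ShortExact.moduleCat_exact_iff_function_exact] at h1 ⊢
    exact Module.Flat.lTensor_exact X h1
  have h2 := (HomologicalComplex.exactAt_iff_isZero_homology _ _).1 h
  have := ModuleCat.subsingleton_of_isZero h2
  exact (torEquiv X N (i + 1)).injective.subsingleton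

end TorLES

/-! ### Dimension shifting along a flat cover. -/

section TorShift

open TensorProduct

variable {R : Type u} [CommRing R] {X K F : Type u} [AddCommGroup X] [Module R X]
  [AddCommGroup K] [Module R K] [AddCommGroup F] [Module R F] [Module.Flat R F]
  {j : K →ₗ[R] F} {p : F →ₗ[R] X} (hj : Function.Injective j) (hjp : Function.Exact j p)
  (hp : Function.Surjective p) (N : Type u) [AddCommGroup N] [Module R N] (i : ℕ)

/-- Dimension shifting in the first variable. -/
noncomputable def torShiftEquiv : TorMod R X N (i + 2) ≃ₗ[R] TorMod R K N (i + 1) :=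
  LinearEquiv.ofBijective (torDelta N (i + 1) hj hjp hp) (by
    have h1 := subsingleton_tor_of_flat (R := R) F N i
    have h2 := subsingleton_tor_of_flat (R := R) F N (i + 1)
    constructor
    · rw [injective_iff_map_eq_zero]
      intro y hy
      obtain ⟨z, rfl⟩ := (torMap_torDelta_exact N (i + 1) hj hjp hp y).1 hy
      rw [Subsingleton.elim z 0, map_zero]
    · intro y
      exact (torDelta_torMap_exact N (i + 1) hj hjp hp y).1 (Subsingleton.elim _ _))

/-- `Tor_1(X, N)` is the kernel of `K ⊗ N → F ⊗ N` for a flat presentation of `X`. -/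
noncomputable def torOneEquiv : TorMod R X N 1 ≃ₗ[R] LinearMap.ker (j.rTensor N) :=
  LinearEquiv.ofBijective (LinearMap.codRestrict _
    ((torZeroEquiv K N).toLinearMap ∘ₗ torDelta N 0 hj hjp hp) (fun y => by
      rw [LinearMap.mem_ker, LinearMap.comp_apply, LinearEquiv.coe_coe, ← torZeroEquiv_torMap,
        (torDelta_torMap_exact N 0 hj hjp hp).apply_apply_eq_zero, map_zero])) (by
    have h1 := subsingleton_tor_of_flat (R := R) F N 0
    constructor
    · rw [injective_iff_map_eq_zero]
      intro y hy
      have hy' := congrArg Subtype.val hy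
      simp only [LinearMap.codRestrict_apply, LinearMap.comp_apply, LinearEquiv.coe_coe,
        ZeroMemClass.coe_zero, LinearEquiv.map_eq_zero_iff] at hy'
      obtain ⟨z, rfl⟩ := (torMap_torDelta_exact N 0 hj hjp hp y).1 hy'
      rw [Subsingleton.elim z 0, map_zero]
    · rintro ⟨y, hy⟩
      obtain ⟨y, rfl⟩ := (torZeroEquiv K N).surjective y
      rw [LinearMap.mem_ker, ← torZeroEquiv_torMap, LinearEquiv.map_eq_zero_iff] at hy
      obtain ⟨z, rfl⟩ := (torDelta_torMap_exact N 0 hj hjp hp y).1 hy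
      exact ⟨z, rfl⟩)

end TorShift

/-! ### Exactness in the second variable, by dimension shifting. -/

section SecondVariable

open TensorProduct

variable {R : Type u} [CommRing R] {N' N N'' : Type u} [AddCommGroup N'] [Module R N']
  [AddCommGroup N] [Module R N] [AddCommGroup N''] [Module R N'']
  {a : N' →ₗ[R] N} {b : N →ₗ[R] N''} (ha : Function.Injective a) (hab : Function.Exact a b)
  (hb : Function.Surjective b)

section Kernel

variable {X K F : Type u} [AddCommGroup X] [Module R X]
  [AddCommGroup K] [Module R K] [AddCommGroup F] [Module R F] [Module.Flat R F]
  {j : K →ₗ[R] F} {p : F →ₗ[R] X} (hj : Function.Injective j) (hjp : Function.Exact j p)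
  (hp : Function.Surjective p)

/-- The map induced by `a` on the kernels of `K ⊗ - → F ⊗ -`. -/
noncomputable def kerRTensorMap (j : K →ₗ[R] F) (a : N' →ₗ[R] N) :
    LinearMap.ker (j.rTensor N') →ₗ[R] LinearMap.ker (j.rTensor N) :=
  LinearMap.restrict (a.lTensor K) (fun y hy => by
    rw [LinearMap.mem_ker] at hy ⊢
    rw [← LinearMap.comp_apply, LinearMap.rTensor_comp_lTensor, ← LinearMap.lTensor_comp_rTensor,
      LinearMap.comp_apply, hy, map_zero])

-- These kernels are Tor_1(X, -) when j presents X. Injectivity of F ⊗ N' → F ⊗ N puts a preimage in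
-- K ⊗ N' back into the kernel.
include ha hab hb in
lemma kerRTensorMap_exact (j : K →ₗ[R] F) :
    Function.Exact (kerRTensorMap j a) (kerRTensorMap j b) := by
  rintro ⟨y, hy⟩
  constructor
  · intro h
    obtain ⟨z, rfl⟩ := (lTensor_exact K hab hb y).1 (congrArg Subtype.val h)
    refine ⟨⟨z, ?_⟩, rfl⟩
    apply Module.Flat.lTensor_preserves_injective_linearMap (M := F) a ha
    rw [map_zero, ← LinearMap.comp_apply, LinearMap.lTensor_comp_rTensor,
      ← LinearMap.rTensor_comp_lTensor, LinearMap.comp_apply]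
    exact hy
  · rintro ⟨z, hz⟩
    rw [← hz]
    exact Subtype.ext ((lTensor_exact K hab hb).apply_apply_eq_zero z.1)

-- The snake lemma applied to K ⊗ - → F ⊗ - gives the connecting map Tor_1(X, N'') → X ⊗ N'.
include ha hab hb hjp hp in
lemma exists_snake : ∃ δ : LinearMap.ker (j.rTensor N'') →ₗ[R] X ⊗[R] N',
    Function.Exact (kerRTensorMap j b) δ ∧ Function.Exact δ (a.lTensor X) := by
  have hinj := Module.Flat.lTensor_preserves_injective_linearMap (M := F) a ha
  have hsurj := LinearMap.lTensor_surjective K hb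
  have h1 : (a.lTensor F) ∘ₗ (j.rTensor N') = (j.rTensor N) ∘ₗ (a.lTensor K) := by
    rw [LinearMap.lTensor_comp_rTensor, LinearMap.rTensor_comp_lTensor]
  have h2 : (b.lTensor F) ∘ₗ (j.rTensor N) = (j.rTensor N'') ∘ₗ (b.lTensor K) := by
    rw [LinearMap.lTensor_comp_rTensor, LinearMap.rTensor_comp_lTensor]
  refine ⟨SnakeLemma.δ' (j.rTensor N') (j.rTensor N) (j.rTensor N'') (a.lTensor K) (b.lTensor K)
    (lTensor_exact K hab hb) (a.lTensor F) (b.lTensor F) (lTensor_exact F hab hb) h1 h2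
    (LinearMap.ker (j.rTensor N'')).subtype (LinearMap.exact_subtype_ker_map _)
    (p.rTensor N') (rTensor_exact N' hjp hp) hsurj hinj, ?_, ?_⟩
  · exact SnakeLemma.exact_δ'_right _ _ _ _ _ _ _ _ _ _ _ (LinearMap.ker (j.rTensor N)).subtype
      (LinearMap.exact_subtype_ker_map _) _ _ _ _ _ _ (kerRTensorMap j b) rfl
      (Submodule.subtype_injective _)
  · exact SnakeLemma.exact_δ'_left _ _ _ _ _ _ _ _ _ _ _ _ _ _ _ (p.rTensor N)
      (rTensor_exact N hjp hp) _ _ (a.lTensor X) (by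
        rw [LinearMap.lTensor_comp_rTensor, LinearMap.rTensor_comp_lTensor])
      (LinearMap.rTensor_surjective N' hp)

end Kernel

lemma exists_finite_flat_cover [IsNoetherianRing R] (X : Type u) [AddCommGroup X] [Module R X]
    [Module.Finite R X] : ∃ (K F : Type u) (_ : AddCommGroup K) (_ : Module R K)
      (_ : AddCommGroup F) (_ : Module R F) (_ : Module.Finite R K) (_ : Module.Flat R F)
      (j : K →ₗ[R] F) (p : F →ₗ[R] X),
      Function.Injective j ∧ Function.Exact j p ∧ Function.Surjective p := by
  obtain ⟨n, p, hp⟩ := Module.Finite.exists_fin' R X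
  exact ⟨LinearMap.ker p, Fin n → R, inferInstance, inferInstance, inferInstance, inferInstance,
    inferInstance, inferInstance, (LinearMap.ker p).subtype, p, Submodule.subtype_injective _,
    LinearMap.exact_subtype_ker_map p, hp⟩

lemma isNoetherian_tor_of_isNoetherian [IsNoetherianRing R] [IsNoetherian R N] (i : ℕ)
    (X : Type u) [AddCommGroup X] [Module R X] [Module.Finite R X] :
    IsNoetherian R (TorMod R X N i) := by
  induction i generalizing X with
  | zero => exact isNoetherian_of_linearEquiv (torZeroEquiv (R := R) X N).symm
  | succ i ih =>
    obtain ⟨K, F, _, _, _, _, _, _, j, p, hj, hjp, hp⟩ := exists_finite_flat_cover (R := R) X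
    cases i with
    | zero =>
      have : IsNoetherian R (K ⊗[R] N) := inferInstance
      exact isNoetherian_of_linearEquiv (torOneEquiv hj hjp hp N).symm
    | succ i =>
      have := ih K
      exact isNoetherian_of_linearEquiv (torShiftEquiv hj hjp hp N i).symm

instance isArtinian_tor [IsNoetherianRing R] [IsArtinian R N] (i : ℕ)
    (X : Type u) [AddCommGroup X] [Module R X] [Module.Finite R X] :
    IsArtinian R (TorMod R X N i) := by
  have htensor (X : Type u) [AddCommGroup X] [Module R X] [Module.Finite R X] :
      IsArtinian R (X ⊗[R] N) := by
    obtain ⟨n, p, hp⟩ := Module.Finite.exists_fin' R X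
    have : IsArtinian R ((Fin n → R) ⊗[R] N) :=
      isArtinian_of_linearEquiv
        ((TensorProduct.comm R _ N).trans (TensorProduct.piScalarRight R R N (Fin n))).symm
    exact isArtinian_of_surjective _ (p.rTensor N) (LinearMap.rTensor_surjective N hp)
  induction i generalizing X with
  | zero =>
    have := htensor X
    exact isArtinian_of_linearEquiv (torZeroEquiv (R := R) X N).symm
  | succ i ih =>
    obtain ⟨K, F, _, _, _, _, _, _, j, p, hj, hjp, hp⟩ := exists_finite_flat_cover (R := R) X
    cases i with
    | zero =>
      have := htensor K
      exact isArtinian_of_linearEquiv (torOneEquiv hj hjp hp N).symm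
    | succ i =>
      have := ih K
      exact isArtinian_of_linearEquiv (torShiftEquiv hj hjp hp N i).symm

-- Degree 0 is right exactness, degree 1 the exact sequence of kernels, and higher degrees shift to
-- the syzygy K of X.
include ha hab hb in
lemma isNoetherian_tor_middle [IsNoetherianRing R] (i : ℕ)
    (X : Type u) [AddCommGroup X] [Module R X] [Module.Finite R X]
    (h' : IsNoetherian R (TorMod R X N' i)) (h'' : IsNoetherian R (TorMod R X N'' i)) :
    IsNoetherian R (TorMod R X N i) := by
  induction i generalizing X with
  | zero =>
    have := isNoetherian_of_linearEquiv (torZeroEquiv (R := R) X N')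
    have := isNoetherian_of_linearEquiv (torZeroEquiv (R := R) X N'')
    have := isNoetherian_of_range_eq_ker _ _ (lTensor_exact X hab hb).linearMap_ker_eq.symm
    exact isNoetherian_of_linearEquiv (torZeroEquiv (R := R) X N).symm
  | succ i ih =>
    obtain ⟨K, F, _, _, _, _, _, _, j, p, hj, hjp, hp⟩ := exists_finite_flat_cover (R := R) X
    cases i with
    | zero =>
      have e (N : Type u) [AddCommGroup N] [Module R N] := torOneEquiv hj hjp hp N
      have := isNoetherian_of_linearEquiv (e N')
      have := isNoetherian_of_linearEquiv (e N'')
      have := isNoetherian_of_range_eq_ker (M := LinearMap.ker (j.rTensor N'))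
        (P := LinearMap.ker (j.rTensor N'')) _ _
        (kerRTensorMap_exact ha hab hb j).linearMap_ker_eq.symm
      exact isNoetherian_of_linearEquiv (e N).symm
    | succ i =>
      have e (N : Type u) [AddCommGroup N] [Module R N] :=
        torShiftEquiv hj hjp hp N i
      have := ih K (isNoetherian_of_linearEquiv (e N')) (isNoetherian_of_linearEquiv (e N''))
      exact isNoetherian_of_linearEquiv (e N).symm

include ha hab hb in
lemma isNoetherian_ker_lTensor [IsNoetherianRing R]
    (X : Type u) [AddCommGroup X] [Module R X] [Module.Finite R X]
    (h'' : IsNoetherian R (TorMod R X N'' 1)) :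
    IsNoetherian R (LinearMap.ker (a.lTensor X)) := by
  obtain ⟨K, F, _, _, _, _, _, _, j, p, hj, hjp, hp⟩ := exists_finite_flat_cover (R := R) X
  have := isNoetherian_of_linearEquiv (torOneEquiv hj hjp hp N'')
  obtain ⟨δ, -, hδ⟩ := exists_snake (j := j) ha hab hb hjp hp
  rw [hδ.linearMap_ker_eq]
  infer_instance

-- This reflects exactness of Tor_{i+1}(X, N'') → Tor_i(X, N') → Tor_i(X, N).
include ha hab hb in
lemma isNoetherian_tor_left [IsNoetherianRing R] (i : ℕ)
    (X : Type u) [AddCommGroup X] [Module R X] [Module.Finite R X]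
    (h'' : IsNoetherian R (TorMod R X N'' (i + 1))) (h : IsNoetherian R (TorMod R X N i)) :
    IsNoetherian R (TorMod R X N' i) := by
  induction i generalizing X with
  | zero =>
    have := isNoetherian_of_linearEquiv (torZeroEquiv (R := R) X N)
    have := isNoetherian_ker_lTensor ha hab hb X h''
    have := isNoetherian_of_range_eq_ker (LinearMap.ker (a.lTensor X)).subtype (a.lTensor X)
      (by simp)
    exact isNoetherian_of_linearEquiv (torZeroEquiv (R := R) X N').symm
  | succ i ih =>
    obtain ⟨K, F, _, _, _, _, _, _, j, p, hj, hjp, hp⟩ := exists_finite_flat_cover (R := R) X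
    have hK := isNoetherian_of_linearEquiv (torShiftEquiv hj hjp hp N'' i)
    cases i with
    | zero =>
      have e (N : Type u) [AddCommGroup N] [Module R N] := torOneEquiv hj hjp hp N
      have := isNoetherian_of_linearEquiv (e N)
      have := isNoetherian_ker_lTensor ha hab hb K hK
      -- The kernel of Tor_1(X, N') → Tor_1(X, N) sits in ker(K ⊗ N' → K ⊗ N), an image of Tor_1(K,
      -- N'') ≅ Tor_2(X, N'').
      let φ : LinearMap.ker (kerRTensorMap j a) →ₗ[R] LinearMap.ker (a.lTensor K) :=
        LinearMap.restrict (LinearMap.ker (j.rTensor N')).subtype (fun y hy =>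
          congrArg Subtype.val hy)
      have := isNoetherian_of_injective φ (fun y z h =>
        Subtype.ext (Subtype.ext (congrArg (fun w : LinearMap.ker (a.lTensor K) => w.1) h)))
      have := isNoetherian_of_range_eq_ker (M := LinearMap.ker (kerRTensorMap j a))
        (P := LinearMap.ker (j.rTensor N)) (Submodule.subtype _)
        (kerRTensorMap j a) (Submodule.range_subtype _)
      exact isNoetherian_of_linearEquiv (e N').symm
    | succ i =>
      have e (N : Type u) [AddCommGroup N] [Module R N] :=
        torShiftEquiv hj hjp hp N i
      have := ih K hK (isNoetherian_of_linearEquiv (e N))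
      exact isNoetherian_of_linearEquiv (e N').symm

-- Only the kernel is assumed Noetherian, not X ⊗ N'. In degree 2 this is applied to the syzygy K,
-- and no finiteness of K ⊗ N' is available.
include ha hab hb in
lemma isNoetherian_tor_one_right [IsNoetherianRing R]
    (X : Type u) [AddCommGroup X] [Module R X] [Module.Finite R X]
    (h : IsNoetherian R (TorMod R X N 1)) (h' : IsNoetherian R (LinearMap.ker (a.lTensor X))) :
    IsNoetherian R (TorMod R X N'' 1) := by
  obtain ⟨K, F, _, _, _, _, _, _, j, p, hj, hjp, hp⟩ := exists_finite_flat_cover (R := R) X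
  have e (N : Type u) [AddCommGroup N] [Module R N] := torOneEquiv hj hjp hp N
  have := isNoetherian_of_linearEquiv (e N)
  obtain ⟨δ, h1, h2⟩ := exists_snake (j := j) ha hab hb hjp hp
  rw [h2.linearMap_ker_eq] at h'
  have := isNoetherian_of_range_eq_ker (M := LinearMap.ker (j.rTensor N))
    (N := LinearMap.ker (j.rTensor N'')) (P := LinearMap.range δ)
    (kerRTensorMap j b) δ.rangeRestrict (by
    rw [LinearMap.ker_rangeRestrict, h1.linearMap_ker_eq])
  exact isNoetherian_of_linearEquiv (e N'').symm

include ha hab hb in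
lemma isNoetherian_tor_right [IsNoetherianRing R] (i : ℕ)
    (X : Type u) [AddCommGroup X] [Module R X] [Module.Finite R X]
    (h : IsNoetherian R (TorMod R X N (i + 1))) (h' : IsNoetherian R (TorMod R X N' i)) :
    IsNoetherian R (TorMod R X N'' (i + 1)) := by
  induction i generalizing X with
  | zero =>
    have := isNoetherian_of_linearEquiv (torZeroEquiv (R := R) X N')
    exact isNoetherian_tor_one_right ha hab hb X h inferInstance
  | succ i ih =>
    obtain ⟨K, F, _, _, _, _, _, _, j, p, hj, hjp, hp⟩ := exists_finite_flat_cover (R := R) X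
    have e (N : Type u) [AddCommGroup N] [Module R N] :=
        torShiftEquiv hj hjp hp N i
    have hK := isNoetherian_of_linearEquiv (e N)
    suffices IsNoetherian R (TorMod R K N'' (i + 1)) from isNoetherian_of_linearEquiv (e N'').symm
    cases i with
    | zero =>
      have := isNoetherian_of_linearEquiv (torOneEquiv hj hjp hp N')
      refine isNoetherian_tor_one_right ha hab hb K hK ?_
      -- As F ⊗ N' → F ⊗ N is injective, ker(K ⊗ N' → K ⊗ N) lies in the copy of Tor_1(X, N') inside
      -- K ⊗ N'.
      refine isNoetherian_of_le (t := LinearMap.ker (j.rTensor N')) fun y hy => ?_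
      apply Module.Flat.lTensor_preserves_injective_linearMap (M := F) a ha
      rw [map_zero, ← LinearMap.comp_apply, LinearMap.lTensor_comp_rTensor,
        ← LinearMap.rTensor_comp_lTensor, LinearMap.comp_apply, LinearMap.mem_ker.1 hy, map_zero]
    | succ i =>
      exact ih K hK (isNoetherian_of_linearEquiv
        (torShiftEquiv hj hjp hp N' i))

lemma isNoetherian_torsionBy_of_injective {A B : Type*} [AddCommGroup A] [Module R A]
    [AddCommGroup B] [Module R B] (e : A →ₗ[R] B) (he : Function.Injective e) (x : R)
    [IsNoetherian R (Submodule.torsionBy R B x)] : IsNoetherian R (Submodule.torsionBy R A x) := by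
  let φ : Submodule.torsionBy R A x →ₗ[R] Submodule.torsionBy R B x :=
    LinearMap.restrict e (fun y hy => by
      rw [Submodule.mem_torsionBy_iff] at hy ⊢
      rw [← map_smul, hy, map_zero])
  exact isNoetherian_of_injective φ (fun y z h =>
    Subtype.ext (he (congrArg (fun w : Submodule.torsionBy R B x => w.1) h)))

include ha in
/-- If `x` is surjective on `N` with kernel `N'`, the kernel of `x` on `Tor_i(X, N)` is Noetherian
when `Tor_i(X, N')` is. -/
lemma isNoetherian_torsionBy_tor [IsNoetherianRing R] {x : R}
    (hax : Function.Exact a (LinearMap.lsmul R N x))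
    (hx : Function.Surjective (LinearMap.lsmul R N x)) (i : ℕ)
    (X : Type u) [AddCommGroup X] [Module R X] [Module.Finite R X]
    (h' : IsNoetherian R (TorMod R X N' i)) :
    IsNoetherian R (Submodule.torsionBy R (TorMod R X N i) x) := by
  have hsmul (Y : Type u) [AddCommGroup Y] [Module R Y] (w : Y ⊗[R] N) :
      (LinearMap.lsmul R N x).lTensor Y w = x • w := by
    induction w using TensorProduct.induction_on with
    | zero => simp
    | tmul a b => rw [LinearMap.lTensor_tmul, LinearMap.lsmul_apply, TensorProduct.tmul_smul]
    | add a b ha hb => rw [map_add, smul_add, ha, hb]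
  induction i generalizing X with
  | zero =>
    have := isNoetherian_of_linearEquiv (torZeroEquiv (R := R) X N')
    have : IsNoetherian R (Submodule.torsionBy R (X ⊗[R] N) x) := by
      have h1 : Submodule.torsionBy R (X ⊗[R] N) x = LinearMap.range (a.lTensor X) := by
        rw [← (lTensor_exact X hax hx).linearMap_ker_eq]
        ext w
        rw [Submodule.mem_torsionBy_iff, LinearMap.mem_ker, hsmul]
      rw [h1]
      infer_instance
    exact isNoetherian_torsionBy_of_injective (torZeroEquiv (R := R) X N).toLinearMap
      (torZeroEquiv X N).injective x
  | succ i ih =>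
    obtain ⟨K, F, _, _, _, _, _, _, j, p, hj, hjp, hp⟩ := exists_finite_flat_cover (R := R) X
    cases i with
    | zero =>
      have e (N : Type u) [AddCommGroup N] [Module R N] := torOneEquiv hj hjp hp N
      have := isNoetherian_of_linearEquiv (e N')
      have : IsNoetherian R (Submodule.torsionBy R (LinearMap.ker (j.rTensor N)) x) := by
        have h1 : Submodule.torsionBy R (LinearMap.ker (j.rTensor N)) x =
            LinearMap.range (kerRTensorMap j a) := by
          rw [← (kerRTensorMap_exact ha hax hx j).linearMap_ker_eq]
          ext w
          rw [Submodule.mem_torsionBy_iff, LinearMap.mem_ker]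
          refine (Subtype.ext_iff.trans ?_).trans Subtype.ext_iff.symm
          change x • w.1 = 0 ↔ (LinearMap.lsmul R N x).lTensor K w.1 = 0
          rw [hsmul]
        rw [h1]
        infer_instance
      exact isNoetherian_torsionBy_of_injective (e N).toLinearMap (e N).injective x
    | succ i =>
      have e (N : Type u) [AddCommGroup N] [Module R N] :=
        torShiftEquiv hj hjp hp N i
      have := ih K (isNoetherian_of_linearEquiv (e N'))
      exact isNoetherian_torsionBy_of_injective (e N).toLinearMap (e N).injective x

end SecondVariable

/-! ### Noetherian Tor modules and the torsion submodule (0 :_N I). -/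

section FiniteLengthTor

open TensorProduct

variable {R : Type u} [CommRing R] [IsNoetherianRing R]

/-- If all `Tor_i(M, N)` are Noetherian, so are all `Tor_i(X, N)` for finite `X` killed by the
annihilator of `M`. -/
theorem isNoetherian_tor_of_annihilator (M N : Type u) [AddCommGroup M] [Module R M]
    [Module.Finite R M] [AddCommGroup N] [Module R N] (h : ∀ i, IsNoetherian R (TorMod R M N i))
    (i : ℕ) (X : Type u) [AddCommGroup X] [Module R X] [Module.Finite R X]
    (hX : Module.annihilator R M ≤ Module.annihilator R X) : IsNoetherian R (TorMod R X N i) := by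
  have ext (i : ℕ) (X : Type u) [AddCommGroup X] [Module R X] [Module.Finite R X]
      (K : Submodule R X) (_ : Module.annihilator R M ≤ Module.annihilator R X)
      (_ : IsNoetherian R (TorMod R K N i)) (_ : IsNoetherian R (TorMod R (X ⧸ K) N i)) :
      IsNoetherian R (TorMod R X N i) :=
    isNoetherian_of_range_eq_ker (M := TorMod R K N i) (P := TorMod R (X ⧸ K) N i)
      (torMap K.subtype N i) (torMap K.mkQ N i)
      (tor_exact N i K.subtype_injective (LinearMap.exact_subtype_mkQ K)
        K.mkQ_surjective).linearMap_ker_eq.symm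
  induction i generalizing X with
  | zero =>
    let P : ∀ (X : Type u) [AddCommGroup X] [Module R X], Prop :=
      fun X _ _ => IsNoetherian R (TorMod R X N 0)
    refine induction_of_annihilator (R := R) M P ?_ (fun X _ _ _ => ext 0 X) (h 0) X hX
    intro X Y _ _ _ _ _ f hf _ (hXt : IsNoetherian R (TorMod R X N 0))
    have : IsNoetherian R (X ⊗[R] N) := isNoetherian_of_linearEquiv (torZeroEquiv (R := R) X N)
    have : IsNoetherian R (Y ⊗[R] N) := isNoetherian_of_surjective (f.rTensor N)
      (LinearMap.range_eq_top.2 (LinearMap.rTensor_surjective N hf))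
    exact isNoetherian_of_linearEquiv (torZeroEquiv (R := R) Y N).symm
  | succ i ih =>
    let P : ∀ (X : Type u) [AddCommGroup X] [Module R X], Prop :=
      fun X _ _ => IsNoetherian R (TorMod R X N (i + 1))
    refine induction_of_annihilator (R := R) M P ?_ (fun X _ _ _ => ext (i + 1) X) (h (i + 1)) X hX
    intro X Y _ _ _ _ _ f hf hMX (hXt : IsNoetherian R (TorMod R X N (i + 1)))
    -- The kernel of f is again finite and killed by Ann M, so the lower degree controls the term
    -- after Tor_{i+1}(Y, N).
    have := ih (LinearMap.ker f)
      (hMX.trans (LinearMap.annihilator_le_of_injective _ (Submodule.subtype_injective _)))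
    exact isNoetherian_of_range_eq_ker (M := TorMod R X N (i + 1))
      (P := TorMod R (LinearMap.ker f) N i) (torMap f N (i + 1))
      (torDelta N i (LinearMap.ker f).subtype_injective (LinearMap.exact_subtype_ker_map f) hf)
      (torMap_torDelta_exact N i (LinearMap.ker f).subtype_injective
        (LinearMap.exact_subtype_ker_map f) hf).linearMap_ker_eq.symm

omit [IsNoetherianRing R] in
lemma isNoetherian_torsionBySet_of_injective {A B : Type*} [AddCommGroup A] [Module R A]
    [AddCommGroup B] [Module R B] (I : Ideal R) (e : A →ₗ[R] B) (he : Function.Injective e)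
    (h : IsNoetherian R (Submodule.torsionBySet R B I)) :
    IsNoetherian R (Submodule.torsionBySet R A I) := by
  let φ : Submodule.torsionBySet R A I →ₗ[R] Submodule.torsionBySet R B I :=
    LinearMap.restrict e (fun y hy => by
      rw [Submodule.mem_torsionBySet_iff] at hy ⊢
      intro r
      rw [← map_smul, hy, map_zero])
  exact isNoetherian_of_injective φ (fun y z h =>
    Subtype.ext (he (congrArg (fun w : Submodule.torsionBySet R B I => w.1) h)))

/-- An isomorphism is read as the exact sequence 0 → N → N' → 0 → 0. -/
lemma isNoetherian_tor_congr {N N' : Type u} [AddCommGroup N] [Module R N] [AddCommGroup N']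
    [Module R N'] (e : N ≃ₗ[R] N') (i : ℕ) (X : Type u) [AddCommGroup X] [Module R X]
    [Module.Finite R X] (h : IsNoetherian R (TorMod R X N i)) :
    IsNoetherian R (TorMod R X N' i) :=
  isNoetherian_tor_middle (N'' := PUnit.{u + 1}) (b := 0) e.injective
    (fun y => ⟨fun _ => e.surjective y, fun _ => rfl⟩) (fun _ => ⟨0, rfl⟩) i X h
    (isNoetherian_tor_of_isNoetherian i X)

/-- If all `Tor_i(X, N)` with `X` finite and killed by `I` are Noetherian, so is `(0 :_N I)`. -/
theorem isNoetherian_torsionBySet_of_tor (I : Ideal R) (N : Type u) [AddCommGroup N] [Module R N]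
    [IsArtinian R N]
    (h : ∀ (X : Type u) [AddCommGroup X] [Module R X] [Module.Finite R X],
      I ≤ Module.annihilator R X → ∀ i, IsNoetherian R (TorMod R X N i)) :
    IsNoetherian R (Submodule.torsionBySet R N I) := by
  refine artinian_module_induction (R := R) (fun N _ _ =>
    (∀ (X : Type u) [AddCommGroup X] [Module R X] [Module.Finite R X],
      I ≤ Module.annihilator R X → ∀ i, IsNoetherian R (TorMod R X N i)) →
    IsNoetherian R (Submodule.torsionBySet R N I)) ?_ ?_ N h
  · intro N N' _ _ _ _ e hN h
    exact isNoetherian_torsionBySet_of_injective I e.symm.toLinearMap e.symm.injective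
      (hN fun X _ _ _ hX i => isNoetherian_tor_congr e.symm i X (h X hX i))
  · clear! N
    intro N _ _ _ ih h
    by_cases hIN : I • (⊤ : Submodule R N) = ⊤
    -- Since x ∈ I, (0 :_N I) lies in ker x, which is proper unless N = 0 and inherits the Tor
    -- hypothesis from 0 → ker x → N → N → 0.
    · obtain ⟨x, hx, hsurj⟩ := exists_surjective_smul N I hIN
      let K := LinearMap.ker (LinearMap.lsmul R N x)
      by_cases hK : K = ⊤
      · have : Subsingleton N := by
          refine subsingleton_of_forall_eq 0 fun y => ?_
          obtain ⟨z, rfl⟩ := hsurj y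
          exact LinearMap.mem_ker.1 (hK ▸ Submodule.mem_top : z ∈ K)
        infer_instance
      · have := ih K hK (fun X _ _ _ hX i =>
          isNoetherian_tor_left K.subtype_injective (LinearMap.exact_subtype_ker_map _) hsurj i X
            (h X hX _) (h X hX _))
        let φ : Submodule.torsionBySet R N I →ₗ[R] Submodule.torsionBySet R K I :=
          LinearMap.codRestrict _ (LinearMap.codRestrict K (Submodule.subtype _)
            (fun y => (Submodule.mem_torsionBySet_iff _ _).1 y.2 ⟨x, hx⟩)) (fun y => by
              rw [Submodule.mem_torsionBySet_iff]
              exact fun r => Subtype.ext ((Submodule.mem_torsionBySet_iff _ _).1 y.2 r))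
        exact isNoetherian_of_injective φ (fun y z hyz => Subtype.ext
          (congrArg (fun w : Submodule.torsionBySet R K I => w.1.1) hyz))
    · let K := I • (⊤ : Submodule R N)
      -- N/IN ≅ Tor_0(R/I, N), so IN inherits the Tor hypothesis, and (0 :_N I) is an extension of a
      -- submodule of N/IN by (0 :_{IN} I).
      have hq : IsNoetherian R (N ⧸ K) := by
        have := h (R ⧸ I) (by rw [Ideal.annihilator_quotient]) 0
        have := isNoetherian_of_linearEquiv (torZeroEquiv (R := R) (R ⧸ I) N)
        exact isNoetherian_of_linearEquiv (TensorProduct.quotTensorEquivQuotSMul N I)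
      have := ih K hIN (fun X _ _ _ hX i =>
        isNoetherian_tor_left K.subtype_injective (LinearMap.exact_subtype_mkQ K)
          K.mkQ_surjective i X (isNoetherian_tor_of_isNoetherian (i + 1) X) (h X hX i))
      let f : Submodule.torsionBySet R N I →ₗ[R] N ⧸ K := K.mkQ ∘ₗ Submodule.subtype _
      let φ : LinearMap.ker f →ₗ[R] Submodule.torsionBySet R K I :=
        LinearMap.codRestrict _ (LinearMap.codRestrict K (Submodule.subtype _ ∘ₗ Submodule.subtype _)
          (fun y => by
            exact (Submodule.Quotient.mk_eq_zero K).1 (LinearMap.mem_ker.1 y.2))) (fun y => by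
              rw [Submodule.mem_torsionBySet_iff]
              exact fun r => Subtype.ext ((Submodule.mem_torsionBySet_iff _ _).1 y.1.2 r))
      have := isNoetherian_of_injective φ (fun y z hyz => Subtype.ext (Subtype.ext
          (congrArg (fun w : Submodule.torsionBySet R K I => w.1.1) hyz)))
      exact isNoetherian_of_range_eq_ker (LinearMap.ker f).subtype f (Submodule.range_subtype _)

/-- Mayer–Vietoris in two steps: N/A ≅ B/(A ∩ B), then N is an extension of N/A by A. -/
lemma isNoetherian_tor_sup {N : Type u} [AddCommGroup N] [Module R N] (A B : Submodule R N)
    (hAB : A ⊔ B = ⊤) (X : Type u) [AddCommGroup X] [Module R X] [Module.Finite R X]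
    (hA : ∀ i, IsNoetherian R (TorMod R X A i)) (hB : ∀ i, IsNoetherian R (TorMod R X B i))
    (hI : ∀ i, IsNoetherian R (TorMod R X (A ⊓ B : Submodule R N) i)) (i : ℕ) :
    IsNoetherian R (TorMod R X N i) := by
  let a := Submodule.inclusion (inf_le_right : A ⊓ B ≤ B)
  let b := A.mkQ ∘ₗ B.subtype
  have hab : Function.Exact a b := by
    intro y
    simp only [b, LinearMap.comp_apply, Submodule.mkQ_apply, Submodule.subtype_apply,
      Submodule.Quotient.mk_eq_zero]
    exact ⟨fun h => ⟨⟨y, h, y.2⟩, rfl⟩, by rintro ⟨z, rfl⟩; exact z.2.1⟩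
  have hb : Function.Surjective b := by
    intro y
    obtain ⟨y, rfl⟩ := A.mkQ_surjective y
    obtain ⟨s, hs, t, ht, rfl⟩ := Submodule.mem_sup.1 (hAB ▸ Submodule.mem_top : y ∈ A ⊔ B)
    refine ⟨⟨t, ht⟩, ?_⟩
    rw [← sub_eq_zero, LinearMap.comp_apply, ← map_sub, Submodule.mkQ_apply,
      Submodule.Quotient.mk_eq_zero]
    simpa using hs
  have hq : IsNoetherian R (TorMod R X (N ⧸ A) i) := by
    cases i with
    | zero =>
      have := isNoetherian_of_linearEquiv (torZeroEquiv (R := R) X B)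
      have := isNoetherian_of_surjective (b.lTensor X)
        (LinearMap.range_eq_top.2 (LinearMap.lTensor_surjective X hb))
      exact isNoetherian_of_linearEquiv (torZeroEquiv (R := R) X (N ⧸ A)).symm
    | succ i =>
      exact isNoetherian_tor_right (Submodule.inclusion_injective _) hab hb i X (hB _) (hI _)
  exact isNoetherian_tor_middle A.subtype_injective (LinearMap.exact_subtype_mkQ A)
    A.mkQ_surjective i X (hA i) hq

/-- If `(0 :_N I)` is Noetherian, so is `Tor_i(X, N)` for all finite `X` killed by `I`. -/
theorem isNoetherian_tor_of_torsionBySet (I : Ideal R) (N : Type u) [AddCommGroup N] [Module R N]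
    [IsArtinian R N] (h : IsNoetherian R (Submodule.torsionBySet R N I))
    (X : Type u) [AddCommGroup X] [Module R X] [Module.Finite R X]
    (hX : I ≤ Module.annihilator R X) (i : ℕ) : IsNoetherian R (TorMod R X N i) := by
  refine artinian_module_induction (R := R) (fun N _ _ =>
    IsNoetherian R (Submodule.torsionBySet R N I) → ∀ i, IsNoetherian R (TorMod R X N i))
    ?_ ?_ N h i
  · intro N N' _ _ _ _ e hN h i
    exact isNoetherian_tor_congr e i X
      (hN (isNoetherian_torsionBySet_of_injective I e.toLinearMap e.injective h) i)
  · clear! N i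
    intro N _ _ _ ih h i
    have ih' (K : Submodule R N) (hK : K ≠ ⊤) (i : ℕ) : IsNoetherian R (TorMod R X K i) :=
      ih K hK (isNoetherian_torsionBySet_of_injective I K.subtype K.subtype_injective h) i
    by_cases hirr : ∃ A B : Submodule R N, A ≠ ⊤ ∧ B ≠ ⊤ ∧ A ⊔ B = ⊤
    · obtain ⟨A, B, hA, hB, hAB⟩ := hirr
      exact isNoetherian_tor_sup A B hAB X (ih' A hA) (ih' B hB)
        (ih' _ fun h => hA (eq_top_iff.2 (h.ge.trans inf_le_left))) i
    · by_cases hN : Subsingleton N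
      · exact isNoetherian_tor_of_isNoetherian i X
      by_cases hsurj : ∃ x ∈ I, Function.Surjective (LinearMap.lsmul R N x)
      · obtain ⟨x, hx, hsurj⟩ := hsurj
        have hK : LinearMap.ker (LinearMap.lsmul R N x) ≠ ⊤ := by
          intro hK
          refine hN (subsingleton_of_forall_eq 0 fun y => ?_)
          obtain ⟨z, rfl⟩ := hsurj y
          exact LinearMap.mem_ker.1 (hK ▸ Submodule.mem_top)
        have h1 := isNoetherian_torsionBy_tor (Submodule.subtype_injective _)
          (LinearMap.exact_subtype_ker_map _) hsurj i X (ih' _ hK i)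
        -- As x kills X it kills Tor_i(X, N), which therefore equals its own x-torsion, already
        -- controlled by Tor_i(X, ker x).
        have h2 : Submodule.torsionBy R (TorMod R X N i) x = ⊤ := by
          rw [eq_top_iff]
          exact fun y _ => (Submodule.mem_torsionBy_iff _ _).2
            (smul_tor_eq_zero i x (Module.mem_annihilator.1 (hX hx)) y)
        rw [h2] at h1
        exact isNoetherian_of_linearEquiv Submodule.topEquiv
      -- N is not a sum of two proper submodules, so by Fitting each element of I, not being
      -- surjective, is nilpotent. Then some power of I kills N, and N itself is Noetherian.
      · have hnil : I ≤ (Module.annihilator R N).radical := by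
          intro x hx
          obtain ⟨n, hn⟩ := ((LinearMap.lsmul R N x :
            Module.End R N).eventually_codisjoint_ker_pow_range_pow.and
              (Filter.eventually_ge_atTop 1)).exists
          have hpow (s : N) : ((LinearMap.lsmul R N x : Module.End R N) ^ n) s = x ^ n • s := by
            rw [Module.End.pow_apply]
            exact smul_iterate_apply x n s
          refine ⟨n, Module.mem_annihilator.2 fun y => ?_⟩
          by_contra hy
          refine hirr ⟨_, _, ?_, ?_, codisjoint_iff.1 hn.1⟩
          · intro hk
            exact hy ((hpow y).symm.trans (LinearMap.mem_ker.1 (hk ▸ Submodule.mem_top)))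
          · intro hr
            refine hsurj ⟨x, hx, fun z => ?_⟩
            obtain ⟨w, hw⟩ := (hr ▸ Submodule.mem_top :
              z ∈ LinearMap.range ((LinearMap.lsmul R N x : Module.End R N) ^ n))
            obtain ⟨k, hk⟩ := Nat.exists_eq_add_of_le' hn.2
            refine ⟨x ^ k • w, ?_⟩
            rw [← hw, hpow, hk, LinearMap.lsmul_apply, smul_smul, pow_succ']
        obtain ⟨k, hk⟩ := Ideal.exists_pow_le_of_le_radical_of_fg hnil (IsNoetherian.noetherian I)
        have h1 := isNoetherian_torsionBySet_pow N I k
        have h2 : Submodule.torsionBySet R N (I ^ k : Ideal R) = ⊤ := by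
          rw [eq_top_iff]
          exact fun y _ => (Submodule.mem_torsionBySet_iff _ _).2
            fun r => Module.mem_annihilator.1 (hk r.2) y
        rw [h2] at h1
        have : IsNoetherian R N := isNoetherian_of_linearEquiv Submodule.topEquiv
        exact isNoetherian_tor_of_isNoetherian i X

end FiniteLengthTor

/-! ### Exact sequences of local homology. -/

section LocalHomologySequence

variable {R : Type u} [CommRing R] (𝔞 : Ideal R) {X X' X'' : Type u} [AddCommGroup X] [Module R X]
  [AddCommGroup X'] [Module R X'] [AddCommGroup X''] [Module R X'']

/-- A single s serves all levels up to n, as needed for linearity of maps that shift the level. -/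
lemma exists_representative (r : AdicCompletion 𝔞 R) (n : ℕ) :
    ∃ s : R, ∀ m ≤ n, AdicCompletion.evalₐ 𝔞 m r = Ideal.Quotient.mk (𝔞 ^ m) s := by
  obtain ⟨a, rfl⟩ := AdicCompletion.mk_surjective 𝔞 R r
  refine ⟨a n, fun m hm => ?_⟩
  rw [AdicCompletion.evalₐ_mk]
  exact (AdicCompletion.Ideal.mk_eq_mk 𝔞 hm a).symm

lemma torMap_comm {Y : Type u} [AddCommGroup Y] [Module R Y]
    {f : X →ₗ[R] X'} {g : X' →ₗ[R] X''} {f' : X →ₗ[R] Y} {g' : Y →ₗ[R] X''}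
    (h : ∀ x, g (f x) = g' (f' x)) (N : Type u) [AddCommGroup N] [Module R N] (i : ℕ)
    (y : TorMod R X N i) : torMap g N i (torMap f N i y) = torMap g' N i (torMap f' N i y) := by
  rw [torMap_torMap, torMap_torMap, LinearMap.ext (f := g ∘ₗ f) (g := g' ∘ₗ f') h]

lemma torMap_torMap_eq {f : X →ₗ[R] X'} {g : X' →ₗ[R] X''} {k : X →ₗ[R] X''}
    (h : ∀ x, g (f x) = k x) (N : Type u) [AddCommGroup N] [Module R N] (i : ℕ)
    (y : TorMod R X N i) : torMap g N i (torMap f N i y) = torMap k N i y := by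
  rw [torMap_torMap, LinearMap.ext (f := g ∘ₗ f) (g := k) h]

lemma torMap_eq_self {f : X →ₗ[R] X} (h : ∀ x, f x = x) (N : Type u) [AddCommGroup N] [Module R N]
    (i : ℕ) (y : TorMod R X N i) : torMap f N i y = y := by
  rw [LinearMap.ext (f := f) (g := LinearMap.id) h, torMap_id]

lemma torMap_torMap_eq_zero {f : X →ₗ[R] X'} {g : X' →ₗ[R] X''} (h : ∀ x, g (f x) = 0)
    (N : Type u) [AddCommGroup N] [Module R N] (i : ℕ) (y : TorMod R X N i) :
    torMap g N i (torMap f N i y) = 0 := by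
  have h0 : g ∘ₗ f = LinearMap.lsmul R X'' 0 ∘ₗ (g ∘ₗ f) := by
    ext x
    simp [h]
  rw [torMap_torMap, h0, ← torMap_torMap, torMap_lsmul, zero_smul]

lemma smul_top_le_comap (f : X' →ₗ[R] X) (J : Ideal R) :
    (J • ⊤ : Submodule R X') ≤ Submodule.comap f (J • ⊤) :=
  Submodule.map_le_iff_le_comap.1 (by
    rw [Submodule.map_smul'']
    exact Submodule.smul_mono le_rfl le_top)

/-- The map `X' / 𝔞ⁿ X' → X / 𝔞ⁿ X` induced by `f`. -/
def quotPowMap (f : X' →ₗ[R] X) (n : ℕ) :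
    (X' ⧸ (𝔞 ^ n • ⊤ : Submodule R X')) →ₗ[R] (X ⧸ (𝔞 ^ n • ⊤ : Submodule R X)) :=
  Submodule.mapQ _ _ f (smul_top_le_comap f _)

variable (N : Type u) [AddCommGroup N] [Module R N] (i : ℕ)

/-- The map induced by `f` on the terms of the inverse systems defining local homology. -/
def termMap (f : X' →ₗ[R] X) (n : ℕ) : Term 𝔞 X' N i n →ₗ[R] Term 𝔞 X N i n :=
  torMap (quotPowMap 𝔞 f n) N i

lemma transition_self {n : ℕ} (y : Term 𝔞 X N i n) : transition 𝔞 X N i le_rfl y = y := by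
  refine torMap_eq_self (f := Submodule.factorPow 𝔞 X (le_refl n)) (fun x => ?_) N i y
  obtain ⟨x, rfl⟩ := Submodule.mkQ_surjective _ x
  rfl

lemma transition_transition {l m n : ℕ} (h₁ : l ≤ m) (h₂ : m ≤ n) (y : Term 𝔞 X N i n) :
    transition 𝔞 X N i h₁ (transition 𝔞 X N i h₂ y) = transition 𝔞 X N i (h₁.trans h₂) y := by
  refine torMap_torMap_eq (f := Submodule.factorPow 𝔞 X h₂) (g := Submodule.factorPow 𝔞 X h₁)
    (k := Submodule.factorPow 𝔞 X (h₁.trans h₂))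
    (fun x => Submodule.factor_comp_apply _ _ x) N i y

lemma termMap_transition (f : X' →ₗ[R] X) {m n : ℕ} (h : m ≤ n) (y : Term 𝔞 X' N i n) :
    termMap 𝔞 N i f m (transition 𝔞 X' N i h y) = transition 𝔞 X N i h (termMap 𝔞 N i f n y) := by
  refine torMap_comm (f := Submodule.factorPow 𝔞 X' h) (g := quotPowMap 𝔞 f m)
    (f' := quotPowMap 𝔞 f n) (g' := Submodule.factorPow 𝔞 X h) (fun x => ?_) N i y
  obtain ⟨x, rfl⟩ := Submodule.mkQ_surjective _ x
  rfl

/-- The map induced by `f` on local homology. -/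
def genLocalHomologyMap (f : X' →ₗ[R] X) :
    genLocalHomology 𝔞 X' N i →ₗ[AdicCompletion 𝔞 R] genLocalHomology 𝔞 X N i where
  toFun y := ⟨fun n => termMap 𝔞 N i f n (y.1 n), fun m n h => by
    rw [← termMap_transition, y.2 h]⟩
  map_add' y z := Subtype.ext (funext fun n => map_add _ _ _)
  map_smul' r y := Subtype.ext (funext fun n => by
    obtain ⟨s, hs⟩ := exists_representative 𝔞 r n
    change termMap 𝔞 N i f n (r • y.1 n) = r • termMap 𝔞 N i f n (y.1 n)
    rw [completion_smul_term _ _ _ _ _ _ (hs n le_rfl),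
      completion_smul_term _ _ _ _ _ _ (hs n le_rfl), map_smul])

lemma genLocalHomologyMap_lsmul (x : R) (y : genLocalHomology 𝔞 X N i) :
    genLocalHomologyMap 𝔞 N i (LinearMap.lsmul R X x) y =
      algebraMap R (AdicCompletion 𝔞 R) x • y := by
  refine Subtype.ext (funext fun n => ?_)
  change termMap 𝔞 N i (LinearMap.lsmul R X x) n (y.1 n) =
    algebraMap R (AdicCompletion 𝔞 R) x • y.1 n
  have hx : AdicCompletion.evalₐ 𝔞 n (algebraMap R (AdicCompletion 𝔞 R) x) =
      Ideal.Quotient.mk (𝔞 ^ n) x := AlgHom.commutes _ _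
  rw [completion_smul_term 𝔞 X N i _ x hx]
  have h : quotPowMap 𝔞 (LinearMap.lsmul R X x) n = LinearMap.lsmul R _ x := by
    ext z
    rfl
  rw [termMap, h]
  exact torMap_lsmul N i x _

variable {f : X' →ₗ[R] X} {g : X →ₗ[R] X''} (hf : Function.Injective f) (hfg : Function.Exact f g)
  (hg : Function.Surjective g)

variable (f) in
/-- The filtration induced on `X'` by the `𝔞`-adic filtration of `X`. -/
abbrev inducedFiltration (n : ℕ) : Submodule R X' := Submodule.comap f (𝔞 ^ n • ⊤)

variable (f) in
lemma inducedFiltration_anti {m n : ℕ} (h : m ≤ n) :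
    inducedFiltration 𝔞 f n ≤ inducedFiltration 𝔞 f m :=
  Submodule.comap_mono (Submodule.smul_mono_left (Ideal.pow_le_pow_right h))

variable (f) in
/-- The embedding of `X' / (X' ∩ 𝔞ⁿ X)` into `X / 𝔞ⁿ X`. -/
def inducedFiltrationMap (n : ℕ) :
    (X' ⧸ inducedFiltration 𝔞 f n) →ₗ[R] (X ⧸ (𝔞 ^ n • ⊤ : Submodule R X)) :=
  Submodule.mapQ _ _ f le_rfl

lemma inducedFiltrationMap_injective (n : ℕ) :
    Function.Injective (inducedFiltrationMap 𝔞 f n) := by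
  rw [← LinearMap.ker_eq_bot, inducedFiltrationMap, Submodule.mapQ, Submodule.ker_liftQ_eq_bot']
  rw [LinearMap.ker_comp, Submodule.ker_mkQ]

include hg in
lemma quotPowMap_surjective (n : ℕ) : Function.Surjective (quotPowMap 𝔞 g n) := by
  intro y
  obtain ⟨y, rfl⟩ := Submodule.mkQ_surjective _ y
  obtain ⟨x, rfl⟩ := hg y
  exact ⟨Submodule.mkQ _ x, rfl⟩

include hfg hg in
lemma inducedFiltrationMap_exact (n : ℕ) :
    Function.Exact (inducedFiltrationMap 𝔞 f n) (quotPowMap 𝔞 g n) := by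
  intro y
  obtain ⟨y, rfl⟩ := Submodule.mkQ_surjective _ y
  constructor
  · intro h
    have h1 : g y ∈ (𝔞 ^ n • ⊤ : Submodule R X'') := (Submodule.Quotient.mk_eq_zero _).1 h
    rw [← LinearMap.range_eq_top.2 hg, LinearMap.range_eq_map, ← Submodule.map_smul''] at h1
    obtain ⟨z, hz, hzy⟩ := h1
    obtain ⟨w, hw⟩ := (hfg (y - z)).1 (by rw [map_sub, hzy, sub_self])
    refine ⟨Submodule.mkQ _ w, ?_⟩
    change Submodule.mkQ _ (f w) = _
    rw [hw, ← sub_eq_zero, ← map_sub, Submodule.mkQ_apply, Submodule.Quotient.mk_eq_zero]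
    simpa using hz
  · rintro ⟨z, hz⟩
    obtain ⟨z, rfl⟩ := Submodule.mkQ_surjective _ z
    rw [← hz]
    change Submodule.mkQ _ (g (f z)) = 0
    rw [hfg.apply_apply_eq_zero, map_zero]

include hf in
/-- The Artin–Rees lemma for the induced filtration. -/
lemma exists_inducedFiltration_le [IsNoetherianRing R] [Module.Finite R X] :
    ∃ c : ℕ, ∀ n, inducedFiltration 𝔞 f (n + c) ≤ 𝔞 ^ n • ⊤ := by
  obtain ⟨c, hc⟩ := 𝔞.exists_pow_inf_eq_pow_smul (LinearMap.range f)
  refine ⟨c, fun n x hx => ?_⟩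
  have h1 : f x ∈ 𝔞 ^ n • LinearMap.range f := by
    have h2 : f x ∈ 𝔞 ^ (n + c) • ⊤ ⊓ LinearMap.range f := ⟨hx, x, rfl⟩
    rw [hc (n + c) (Nat.le_add_left c n), Nat.add_sub_cancel] at h2
    exact Submodule.smul_mono le_rfl inf_le_right h2
  rw [LinearMap.range_eq_map, ← Submodule.map_smul''] at h1
  obtain ⟨z, hz, hzx⟩ := h1
  rwa [← hf hzx]

variable [IsNoetherianRing R]

instance [Module.Finite R X] [IsArtinian R N] (n : ℕ) : IsArtinian R (Term 𝔞 X N i n) :=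
  isArtinian_tor i _

include hf hfg hg in
/-- Exactness of local homology in the middle. -/
theorem genLocalHomology_exact [Module.Finite R X] [Module.Finite R X'] [IsArtinian R N] :
    Function.Exact (genLocalHomologyMap 𝔞 N i f) (genLocalHomologyMap 𝔞 N i g) := by
  intro y
  constructor
  · intro hy
    obtain ⟨c, hc⟩ := exists_inducedFiltration_le 𝔞 hf
    -- The sequences are exact levelwise for X'/(X' ∩ 𝔞ⁿX), not for X'/𝔞ⁿX'. The lift is made there
    -- and carried over afterwards by Artin–Rees, at the cost of an index shift c.
    obtain ⟨a, ha, hay⟩ := exists_compatible_lift (R := R)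
      (A := fun n => TorMod R (X' ⧸ inducedFiltration 𝔞 f n) N i) (B := fun n => Term 𝔞 X N i n)
      (fun m n h => torMap (Submodule.factor (inducedFiltration_anti 𝔞 f h)) N i)
      (fun n z => by
        refine torMap_eq_self (f := Submodule.factor (inducedFiltration_anti 𝔞 f (le_refl n)))
          (fun x => ?_) N i z
        obtain ⟨x, rfl⟩ := Submodule.mkQ_surjective _ x
        rfl)
      (fun l m n h₁ h₂ z => by
        refine torMap_torMap_eq (f := Submodule.factor (inducedFiltration_anti 𝔞 f h₂))
          (g := Submodule.factor (inducedFiltration_anti 𝔞 f h₁))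
          (k := Submodule.factor (inducedFiltration_anti 𝔞 f (h₁.trans h₂)))
          (fun x => Submodule.factor_comp_apply _ _ x) N i z)
      (fun m n h => transition 𝔞 X N i h)
      (fun n => torMap (inducedFiltrationMap 𝔞 f n) N i)
      (fun m n h z => by
        refine torMap_comm (f := Submodule.factor (inducedFiltration_anti 𝔞 f h))
          (g := inducedFiltrationMap 𝔞 f m) (f' := inducedFiltrationMap 𝔞 f n)
          (g' := Submodule.factorPow 𝔞 X h) (fun x => ?_) N i z
        obtain ⟨x, rfl⟩ := Submodule.mkQ_surjective _ x
        rfl)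
      y.1 y.2 (fun n => (tor_exact N i (inducedFiltrationMap_injective 𝔞 n)
        (inducedFiltrationMap_exact 𝔞 hfg hg n) (quotPowMap_surjective 𝔞 hg n) _).1
          (congrFun (congrArg Subtype.val hy) n))
    refine ⟨⟨fun n => torMap (Submodule.factor (hc n)) N i (a (n + c)), fun m n h => ?_⟩, ?_⟩
    · refine Eq.trans ?_ (congrArg (torMap (Submodule.factor (hc m)) N i)
        (ha (Nat.add_le_add_right h c)))
      refine torMap_comm (f := Submodule.factor (hc n)) (g := Submodule.factorPow 𝔞 X' h)
        (f' := Submodule.factor (inducedFiltration_anti 𝔞 f (Nat.add_le_add_right h c)))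
        (g' := Submodule.factor (hc m)) (fun x => (Submodule.factor_comp_apply _ _ x).trans
          (Submodule.factor_comp_apply _ _ x).symm) N i (a (n + c))
    · refine Subtype.ext (funext fun n => ?_)
      change torMap (quotPowMap 𝔞 f n) N i (torMap (Submodule.factor (hc n)) N i (a (n + c))) = y.1 n
      rw [← y.2 (Nat.le_add_right n c), ← hay (n + c)]
      refine torMap_comm (f := Submodule.factor (hc n)) (g := quotPowMap 𝔞 f n)
        (f' := inducedFiltrationMap 𝔞 f (n + c))
        (g' := Submodule.factorPow 𝔞 X (Nat.le_add_right n c)) (fun x => ?_) N i (a (n + c))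
      obtain ⟨x, rfl⟩ := Submodule.mkQ_surjective _ x
      rfl
  · rintro ⟨z, rfl⟩
    refine Subtype.ext (funext fun n => ?_)
    refine torMap_torMap_eq_zero (f := quotPowMap 𝔞 f n) (g := quotPowMap 𝔞 g n) (fun x => ?_) N i
      (z.1 n)
    obtain ⟨x, rfl⟩ := Submodule.mkQ_surjective _ x
    change (𝔞 ^ n • ⊤ : Submodule R X'').mkQ (g (f x)) = 0
    rw [hfg.apply_apply_eq_zero, map_zero]

include hf hfg hg in
/-- A connecting map in local homology, exact at its source. -/
theorem exists_genLocalHomology_delta [Module.Finite R X] [IsArtinian R N] :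
    ∃ δ : genLocalHomology 𝔞 X'' N (i + 1) →ₗ[AdicCompletion 𝔞 R] genLocalHomology 𝔞 X' N i,
      ∀ y, δ y = 0 → ∃ z, genLocalHomologyMap 𝔞 N (i + 1) g z = y := by
  obtain ⟨c, hc⟩ := exists_inducedFiltration_le 𝔞 hf
  let d (n : ℕ) : Term 𝔞 X'' N (i + 1) n →ₗ[R] TorMod R (X' ⧸ inducedFiltration 𝔞 f n) N i :=
    torDelta N i (inducedFiltrationMap_injective 𝔞 n)
        (inducedFiltrationMap_exact 𝔞 hfg hg n) (quotPowMap_surjective 𝔞 hg n)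
  have hd {m n : ℕ} (h : m ≤ n) (y : Term 𝔞 X'' N (i + 1) n) :
      torMap (Submodule.factor (inducedFiltration_anti 𝔞 f h)) N i (d n y) =
        d m (transition 𝔞 X'' N (i + 1) h y) :=
    torDelta_naturality N i _ _ _ _ _ _ (Submodule.factor (inducedFiltration_anti 𝔞 f h))
      (Submodule.factorPow 𝔞 X h) (Submodule.factorPow 𝔞 X'' h) (by ext x; rfl) (by ext x; rfl) y
  let e (n : ℕ) : Term 𝔞 X'' N (i + 1) (n + c) →ₗ[R] Term 𝔞 X' N i n :=
    torMap (Submodule.factor (hc n)) N i ∘ₗ d (n + c)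
  have he {m n : ℕ} (h : m ≤ n) (y : Term 𝔞 X'' N (i + 1) (n + c)) :
      transition 𝔞 X' N i h (e n y) =
        e m (transition 𝔞 X'' N (i + 1) (Nat.add_le_add_right h c) y) := by
    change _ = torMap (Submodule.factor (hc m)) N i (d (m + c) _)
    rw [← hd]
    refine torMap_comm (f := Submodule.factor (hc n)) (g := Submodule.factorPow 𝔞 X' h)
      (f' := Submodule.factor (inducedFiltration_anti 𝔞 f (Nat.add_le_add_right h c)))
      (g' := Submodule.factor (hc m)) (fun x => (Submodule.factor_comp_apply _ _ x).trans
        (Submodule.factor_comp_apply _ _ x).symm) N i (d (n + c) y)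
  let δ : genLocalHomology 𝔞 X'' N (i + 1) →ₗ[AdicCompletion 𝔞 R] genLocalHomology 𝔞 X' N i :=
    { toFun := fun y => ⟨fun n => e n (y.1 (n + c)), fun m n h => by rw [he, y.2]⟩
      map_add' := fun y z => Subtype.ext (funext fun n => map_add _ _ _)
      map_smul' := fun r y => Subtype.ext (funext fun n => by
        obtain ⟨s, hs⟩ := exists_representative 𝔞 r (n + c)
        change e n (r • y.1 (n + c)) = r • e n (y.1 (n + c))
        rw [completion_smul_term _ _ _ _ _ _ (hs (n + c) le_rfl),
          completion_smul_term _ _ _ _ _ _ (hs n (Nat.le_add_right n c)), map_smul]) }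
  refine ⟨δ, fun y hy => ?_⟩
  -- Projecting further from X'/𝔞ⁿX' to X'/(X' ∩ 𝔞ⁿX) undoes the Artin–Rees shift and recovers the
  -- unshifted connecting map.
  have hy' (n : ℕ) : d n (y.1 n) = 0 := by
    have h1 : e n (y.1 (n + c)) = 0 := congrFun (congrArg Subtype.val hy) n
    rw [← y.2 (Nat.le_add_right n c), ← hd]
    have h2 := congrArg (torMap (Submodule.factor (smul_top_le_comap f (𝔞 ^ n))) N i) h1
    refine Eq.trans ?_ (h2.trans (map_zero _))
    refine (torMap_torMap_eq (f := Submodule.factor (hc n))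
      (g := Submodule.factor (smul_top_le_comap f (𝔞 ^ n)))
      (k := Submodule.factor (inducedFiltration_anti 𝔞 f (Nat.le_add_right n c)))
      (fun x => Submodule.factor_comp_apply _ _ x) N i (d (n + c) (y.1 (n + c)))).symm
  obtain ⟨z, hz, hzy⟩ := exists_compatible_lift (R := R)
    (A := fun n => Term 𝔞 X N (i + 1) n) (B := fun n => Term 𝔞 X'' N (i + 1) n)
    (fun m n h => transition 𝔞 X N (i + 1) h) (fun n z => transition_self 𝔞 N (i + 1) z)
    (fun l m n h₁ h₂ z => transition_transition 𝔞 N (i + 1) h₁ h₂ z)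
    (fun m n h => transition 𝔞 X'' N (i + 1) h) (fun n => termMap 𝔞 N (i + 1) g n)
    (fun m n h z => termMap_transition 𝔞 N (i + 1) g h z) y.1 y.2
    (fun n => (torMap_torDelta_exact N i (inducedFiltrationMap_injective 𝔞 n)
        (inducedFiltrationMap_exact 𝔞 hfg hg n) (quotPowMap_surjective 𝔞 hg n) _).1 (hy' n))
  exact ⟨⟨z, hz⟩, Subtype.ext (funext hzy)⟩

end LocalHomologySequence

/-! ### Finiteness of local homology over the completion. -/

section LocalHomologyFinite

variable {R : Type u} [CommRing R] (𝔞 : Ideal R) {X X' X'' : Type u} [AddCommGroup X] [Module R X]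
  [AddCommGroup X'] [Module R X'] [AddCommGroup X''] [Module R X'']
  (N : Type u) [AddCommGroup N] [Module R N] (i : ℕ)

instance (n : ℕ) : IsScalarTower R (AdicCompletion 𝔞 R) (Term 𝔞 X N i n) where
  smul_assoc r a y := by
    obtain ⟨s, hs⟩ := exists_representative 𝔞 a n
    rw [completion_smul_term 𝔞 X N i a s (hs n le_rfl),
      completion_smul_term 𝔞 X N i (r • a) (r * s) (by
        rw [map_smul, hs n le_rfl, ← smul_eq_mul, ← Ideal.Quotient.mk_eq_mk, ← Ideal.Quotient.mk_eq_mk,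
          Submodule.Quotient.mk_smul]), mul_smul]

/-- On the n-th term each element of the completion acts as an element of R, so the two kinds of
span agree. -/
lemma finite_term_iff (n : ℕ) :
    Module.Finite (AdicCompletion 𝔞 R) (Term 𝔞 X N i n) ↔ Module.Finite R (Term 𝔞 X N i n) := by
  refine ⟨fun ⟨S, hS⟩ => ⟨S, ?_⟩, fun h => Module.Finite.of_restrictScalars_finite R _ _⟩
  refine eq_top_iff.2 fun y _ => ?_
  have hy : y ∈ Submodule.span (AdicCompletion 𝔞 R) (S : Set (Term 𝔞 X N i n)) := hS ▸ trivial
  induction hy using Submodule.span_induction with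
  | mem y hy => exact Submodule.subset_span hy
  | zero => exact zero_mem _
  | add y z _ _ hy hz => exact add_mem (hy trivial) (hz trivial)
  | smul a y _ hy =>
    obtain ⟨s, hs⟩ := exists_representative 𝔞 a n
    rw [completion_smul_term 𝔞 X N i a s (hs n le_rfl)]
    exact Submodule.smul_mem _ _ (hy trivial)

/-- The projection of local homology onto the `n`-th term of the inverse system. -/
def genLocalHomologyEval (n : ℕ) :
    genLocalHomology 𝔞 X N i →ₗ[AdicCompletion 𝔞 R] Term 𝔞 X N i n :=
  LinearMap.proj n ∘ₗ (genLocalHomology 𝔞 X N i).subtype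

/-- If `𝔞` kills `X`, then the inverse system defining local homology is constant from `n = 1`. -/
lemma genLocalHomologyEval_bijective (hX : 𝔞 ≤ Module.annihilator R X) :
    Function.Bijective (genLocalHomologyEval 𝔞 (X := X) N i 1) := by
  have hbot : (𝔞 ^ 1 • ⊤ : Submodule R X) = ⊥ := by
    rw [pow_one, eq_bot_iff, Submodule.smul_le]
    exact fun r hr x _ => Module.mem_annihilator.1 (hX hr) x
  have hle (n : ℕ) : (𝔞 ^ 1 • ⊤ : Submodule R X) ≤ 𝔞 ^ n • ⊤ := hbot ▸ bot_le
  constructor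
  · refine (injective_iff_map_eq_zero _).2 fun y hy => Subtype.ext (funext fun n => ?_)
    replace hy : y.1 1 = 0 := hy
    -- Level 0 belongs to X/X = 0 and lies below level 1, so it is treated apart.
    rcases Nat.eq_zero_or_pos n with rfl | hn
    · rw [← y.2 zero_le_one, hy, map_zero]
      rfl
    · have h := y.2 hn
      rw [hy] at h
      have h1 : torMap (Submodule.factor (hle n)) N i (transition 𝔞 X N i hn (y.1 n)) = y.1 n := by
        refine (torMap_torMap_eq (f := Submodule.factorPow 𝔞 X hn) (k := LinearMap.id) (fun x => ?_)
          N i (y.1 n)).trans (torMap_id N i _)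
        obtain ⟨x, rfl⟩ := Submodule.mkQ_surjective _ x
        rfl
      exact h1.symm.trans ((congrArg _ h).trans (map_zero _))
  · intro y
    refine ⟨⟨fun n => torMap (Submodule.factor (hle n)) N i y, fun m n h => ?_⟩, ?_⟩
    · exact torMap_torMap_eq (f := Submodule.factor (hle n)) (g := Submodule.factorPow 𝔞 X h)
        (k := Submodule.factor (hle m)) (fun x => Submodule.factor_comp_apply _ _ x) N i y
    · refine torMap_eq_self (f := Submodule.factor (hle 1)) (fun x => ?_) N i y
      obtain ⟨x, rfl⟩ := Submodule.mkQ_surjective _ x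
      rfl

variable [IsNoetherianRing R]

/-- If `𝔞` kills `X`, then `H_i(X, N)` is finite exactly when `Tor_i(X, N)` is Noetherian. -/
lemma finite_genLocalHomology_iff_of_le_annihilator (hX : 𝔞 ≤ Module.annihilator R X) :
    Module.Finite (AdicCompletion 𝔞 R) (genLocalHomology 𝔞 X N i) ↔
      IsNoetherian R (TorMod R X N i) := by
  have hbot : (𝔞 ^ 1 • ⊤ : Submodule R X) = ⊥ := by
    rw [pow_one, eq_bot_iff, Submodule.smul_le]
    exact fun r hr x _ => Module.mem_annihilator.1 (hX hr) x
  let e : Term 𝔞 X N i 1 ≃ₗ[R] TorMod R X N i :=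
    torCongr N i ((𝔞 ^ 1 • ⊤ : Submodule R X).quotEquivOfEqBot hbot)
  rw [Module.Finite.equiv_iff (LinearEquiv.ofBijective _ (genLocalHomologyEval_bijective 𝔞 N i hX)),
    finite_term_iff, Module.Finite.equiv_iff e]
  exact ⟨fun _ => isNoetherian_of_isNoetherianRing_of_finite R _, fun _ => inferInstance⟩

/-- Right exactness of the tensor product gives lifts at each level; Mittag-Leffler makes them
compatible. -/
lemma genLocalHomologyMap_surjective_zero [Module.Finite R X] [IsArtinian R N] {g : X →ₗ[R] X''}
    (hg : Function.Surjective g) : Function.Surjective (genLocalHomologyMap 𝔞 N 0 g) := by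
  intro y
  obtain ⟨z, hz, hzy⟩ := exists_compatible_lift (R := R)
    (A := fun n => Term 𝔞 X N 0 n) (B := fun n => Term 𝔞 X'' N 0 n)
    (fun m n h => transition 𝔞 X N 0 h) (fun n z => transition_self 𝔞 N 0 z)
    (fun l m n h₁ h₂ z => transition_transition 𝔞 N 0 h₁ h₂ z)
    (fun m n h => transition 𝔞 X'' N 0 h) (fun n => termMap 𝔞 N 0 g n)
    (fun m n h z => termMap_transition 𝔞 N 0 g h z) y.1 y.2
    (fun n => by
      obtain ⟨w, hw⟩ := LinearMap.rTensor_surjective N (quotPowMap_surjective 𝔞 hg n)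
        (torZeroEquiv _ N (y.1 n))
      refine ⟨(torZeroEquiv _ N).symm w, (torZeroEquiv _ N).injective ?_⟩
      refine (torZeroEquiv_torMap (quotPowMap 𝔞 g n) N _).trans ?_
      rw [LinearEquiv.apply_symm_apply, hw])
  exact ⟨⟨z, hz⟩, Subtype.ext (funext hzy)⟩

variable [IsArtinian R N]

lemma finite_genLocalHomology_middle {f : X' →ₗ[R] X} {g : X →ₗ[R] X''}
    (hf : Function.Injective f) (hfg : Function.Exact f g) (hg : Function.Surjective g)
    [Module.Finite R X] [Module.Finite R X']
    (h' : Module.Finite (AdicCompletion 𝔞 R) (genLocalHomology 𝔞 X' N i))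
    (h'' : Module.Finite (AdicCompletion 𝔞 R) (genLocalHomology 𝔞 X'' N i)) :
    Module.Finite (AdicCompletion 𝔞 R) (genLocalHomology 𝔞 X N i) := by
  have := isNoetherian_of_isNoetherianRing_of_finite (AdicCompletion 𝔞 R)
    (genLocalHomology 𝔞 X' N i)
  have := isNoetherian_of_isNoetherianRing_of_finite (AdicCompletion 𝔞 R)
    (genLocalHomology 𝔞 X'' N i)
  have := isNoetherian_of_range_eq_ker (genLocalHomologyMap 𝔞 N i f) (genLocalHomologyMap 𝔞 N i g)
    (genLocalHomology_exact 𝔞 N i hf hfg hg).linearMap_ker_eq.symm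
  infer_instance

lemma finite_genLocalHomology_right {f : X' →ₗ[R] X} {g : X →ₗ[R] X''}
    (hf : Function.Injective f) (hfg : Function.Exact f g) (hg : Function.Surjective g)
    [Module.Finite R X]
    (h : Module.Finite (AdicCompletion 𝔞 R) (genLocalHomology 𝔞 X N (i + 1)))
    (h' : Module.Finite (AdicCompletion 𝔞 R) (genLocalHomology 𝔞 X' N i)) :
    Module.Finite (AdicCompletion 𝔞 R) (genLocalHomology 𝔞 X'' N (i + 1)) := by
  have := isNoetherian_of_isNoetherianRing_of_finite (AdicCompletion 𝔞 R)
    (genLocalHomology 𝔞 X N (i + 1))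
  have := isNoetherian_of_isNoetherianRing_of_finite (AdicCompletion 𝔞 R)
    (genLocalHomology 𝔞 X' N i)
  obtain ⟨δ, hδ⟩ := exists_genLocalHomology_delta 𝔞 N i hf hfg hg
  have : IsNoetherian (AdicCompletion 𝔞 R) (LinearMap.ker δ) :=
    isNoetherian_of_le (t := LinearMap.range (genLocalHomologyMap 𝔞 N (i + 1) g)) hδ
  have := isNoetherian_of_range_eq_ker (M := LinearMap.ker δ) (P := genLocalHomology 𝔞 X' N i)
    (LinearMap.ker δ).subtype δ (Submodule.range_subtype _)
  exact Module.IsNoetherian.finite _ _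

/-- If all `H_i(M, N)` are finite, so are all `H_i(X, N)` with `X` finite and killed by the
annihilator of `M`. -/
theorem finite_genLocalHomology_of_annihilator (M : Type u) [AddCommGroup M] [Module R M]
    [Module.Finite R M]
    (h : ∀ i, Module.Finite (AdicCompletion 𝔞 R) (genLocalHomology 𝔞 M N i)) (X : Type u)
    [AddCommGroup X] [Module R X] [Module.Finite R X]
    (hX : Module.annihilator R M ≤ Module.annihilator R X) :
    Module.Finite (AdicCompletion 𝔞 R) (genLocalHomology 𝔞 X N i) := by
  induction i generalizing X with
  | zero =>
    let P : ∀ (X : Type u) [AddCommGroup X] [Module R X], Prop :=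
      fun X _ _ => Module.Finite (AdicCompletion 𝔞 R) (genLocalHomology 𝔞 X N 0)
    refine induction_of_annihilator (R := R) M P ?_ ?_ (h 0) X hX
    · intro X Y _ _ _ _ _ f hf _ hXf
      exact Module.Finite.of_surjective (hM := hXf) _ (genLocalHomologyMap_surjective_zero 𝔞 N hf)
    · intro X _ _ _ K _
      exact finite_genLocalHomology_middle 𝔞 N 0 K.subtype_injective (LinearMap.exact_subtype_mkQ K)
        K.mkQ_surjective
  | succ i ih =>
    let P : ∀ (X : Type u) [AddCommGroup X] [Module R X], Prop :=
      fun X _ _ => Module.Finite (AdicCompletion 𝔞 R) (genLocalHomology 𝔞 X N (i + 1))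
    refine induction_of_annihilator (R := R) M P ?_ ?_ (h (i + 1)) X hX
    · intro X Y _ _ _ _ _ f hf hMX hXf
      exact finite_genLocalHomology_right 𝔞 N i (LinearMap.ker f).subtype_injective
        (LinearMap.exact_subtype_ker_map f) hf hXf (ih (LinearMap.ker f)
          (hMX.trans (LinearMap.annihilator_le_of_injective _ (Submodule.subtype_injective _))))
    · intro X _ _ _ K _
      exact finite_genLocalHomology_middle 𝔞 N (i + 1) K.subtype_injective
        (LinearMap.exact_subtype_mkQ K) K.mkQ_surjective

theorem isNoetherian_torsionBySet_of_genLocalHomology (M : Type u) [AddCommGroup M] [Module R M]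
    [Module.Finite R M]
    (h : ∀ i, Module.Finite (AdicCompletion 𝔞 R) (genLocalHomology 𝔞 M N i)) :
    IsNoetherian R (Submodule.torsionBySet R N (𝔞 ⊔ Module.annihilator R M : Ideal R)) :=
  isNoetherian_torsionBySet_of_tor _ N fun X _ _ _ hX i =>
    (finite_genLocalHomology_iff_of_le_annihilator 𝔞 N i (le_sup_left.trans hX)).1
      (finite_genLocalHomology_of_annihilator 𝔞 N i M h X (le_sup_right.trans hX))

omit [IsArtinian R N] in
/-- Nakayama's lemma for local homology. -/
lemma finite_genLocalHomology_of_smul_quotient (x : R) (hx : x ∈ 𝔞) {B : Type u} [AddCommGroup B]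
    [Module (AdicCompletion 𝔞 R) B] [Module.Finite (AdicCompletion 𝔞 R) B]
    (g : genLocalHomology 𝔞 X N i →ₗ[AdicCompletion 𝔞 R] B)
    (hg : ∀ y, g y = 0 → ∃ z, algebraMap R (AdicCompletion 𝔞 R) x • z = y) :
    Module.Finite (AdicCompletion 𝔞 R) (genLocalHomology 𝔞 X N i) := by
  obtain ⟨k, v, hv⟩ := Submodule.fg_iff_exists_fin_generating_family.1
    (IsNoetherian.noetherian (LinearMap.range g))
  have hv' (j : Fin k) : ∃ w, g w = v j := by
    have : v j ∈ LinearMap.range g := hv ▸ Submodule.subset_span ⟨j, rfl⟩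
    exact this
  choose w hw using hv'
  -- A free module on preimages of generators of im g, written as the completion of Rᵏ so that it is
  -- visibly 𝔞-adically complete. The target is 𝔞-adically separated, so surjectivity modulo 𝔞
  -- suffices.
  let φ : AdicCompletion 𝔞 (Fin k → R) →ₗ[AdicCompletion 𝔞 R] genLocalHomology 𝔞 X N i :=
    Fintype.linearCombination (AdicCompletion 𝔞 R) w ∘ₗ
      (AdicCompletion.piEquivFin 𝔞 k).toLinearMap
  have : IsAdicComplete 𝔞 (AdicCompletion 𝔞 (Fin k → R)) :=
    AdicCompletion.isAdicComplete (IsNoetherian.noetherian 𝔞)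
  have : IsHausdorff 𝔞 (genLocalHomology 𝔞 X N i) := by
    refine ⟨fun y hy => Subtype.ext (funext fun n => ?_)⟩
    have hle : (𝔞 ^ n • ⊤ : Submodule R (genLocalHomology 𝔞 X N i)) ≤
        LinearMap.ker ((genLocalHomologyEval 𝔞 N i n).restrictScalars R) :=
      Submodule.smul_le.2 fun r hr z _ => term_isTorsion 𝔞 X N i n (a := ⟨r, hr⟩) (x := z.1 n)
    exact hle (SModEq.zero.1 (hy n))
  have hφ : Function.Surjective (φ.restrictScalars R) := by
    refine surjective_of_mkQ_comp_surjective (I := 𝔞) fun y => ?_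
    obtain ⟨y, rfl⟩ := Submodule.mkQ_surjective _ y
    have hy : g y ∈ Submodule.span (AdicCompletion 𝔞 R) (Set.range v) := hv ▸ ⟨y, rfl⟩
    obtain ⟨c, hc⟩ := (Submodule.mem_span_range_iff_exists_fun _).1 hy
    -- The error of approximating y by the w_j lies in ker g, hence in x H ⊆ 𝔞 H.
    obtain ⟨z, hz⟩ := hg (Fintype.linearCombination (AdicCompletion 𝔞 R) w c - y) (by
      rw [map_sub, Fintype.linearCombination_apply, map_sum]
      simp only [map_smul, hw, hc, sub_self])
    refine ⟨(AdicCompletion.piEquivFin 𝔞 k).symm c, ?_⟩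
    change Submodule.mkQ _ (Fintype.linearCombination (AdicCompletion 𝔞 R) w
      (AdicCompletion.piEquivFin 𝔞 k ((AdicCompletion.piEquivFin 𝔞 k).symm c))) = _
    rw [LinearEquiv.apply_symm_apply, ← sub_eq_zero, ← map_sub, ← hz, algebraMap_smul,
      Submodule.mkQ_apply, Submodule.Quotient.mk_eq_zero]
    exact Submodule.smul_mem_smul hx trivial
  have : Module.Finite (AdicCompletion 𝔞 R) (AdicCompletion 𝔞 (Fin k → R)) :=
    Module.Finite.equiv (AdicCompletion.piEquivFin 𝔞 k).symm
  exact Module.Finite.of_surjective φ hφ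

/-- If `(0 :_N 𝔞 + I)` is Noetherian, then `H_i(X, N)` is finite for all finite `X` killed by
`I`. -/
theorem finite_genLocalHomology_of_torsionBySet (I : Ideal R)
    (h : IsNoetherian R (Submodule.torsionBySet R N (𝔞 ⊔ I : Ideal R)))
    (X : Type u) [AddCommGroup X] [Module R X] [Module.Finite R X]
    (hX : I ≤ Module.annihilator R X) :
    Module.Finite (AdicCompletion 𝔞 R) (genLocalHomology 𝔞 X N i) := by
  induction I using IsNoetherian.induction generalizing X with
  | hgt I ih =>
  revert hX
  induction ‹Module.Finite R X› using IsNoetherianRing.induction_on_isQuotientEquivQuotientPrime R with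
  | subsingleton X =>
    intro hX
    refine (finite_genLocalHomology_iff_of_le_annihilator 𝔞 N i ?_).2
      (isNoetherian_tor_of_torsionBySet _ N h X ?_ i)
    all_goals rw [Module.annihilator_eq_top_iff.2 ‹_›]; exact le_top
  | quotient X p e =>
    intro hX
    have hann : Module.annihilator R X = p.1 := by
      rw [e.annihilator_eq, Ideal.annihilator_quotient]
    by_cases hp : 𝔞 ≤ p.1
    · rw [← hann] at hp
      exact (finite_genLocalHomology_iff_of_le_annihilator 𝔞 N i hp).2
        (isNoetherian_tor_of_torsionBySet _ N h X (sup_le hp hX) i)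
    · obtain ⟨x, hx, hxp⟩ := SetLike.not_le_iff_exists.1 hp
      have hinj : Function.Injective (LinearMap.lsmul R X x) := by
        refine (injective_iff_map_eq_zero _).2 fun a ha => e.injective ?_
        obtain ⟨r, hr⟩ := Ideal.Quotient.mk_surjective (e a)
        have h1 : e (x • a) = 0 := (congrArg e ha).trans (map_zero e)
        rw [map_smul, ← hr, ← Ideal.Quotient.mk_eq_mk, ← Submodule.Quotient.mk_smul,
          Submodule.Quotient.mk_eq_zero] at h1
        rw [map_zero, ← hr, Ideal.Quotient.eq_zero_iff_mem]
        exact (p.2.mem_or_mem h1).resolve_left hxp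
      let K := LinearMap.range (LinearMap.lsmul R X x)
      -- X/xX is killed by I + (x), which is strictly larger because I ⊆ p and x ∉ p; the Noetherian
      -- induction on I applies to it.
      have hI : I < I ⊔ Ideal.span {x} := by
        refine lt_of_le_of_ne le_sup_left fun hI => hxp (hann ▸ hX ?_)
        rw [hI]
        exact Ideal.mem_sup_right (Ideal.mem_span_singleton_self x)
      have hK := ih _ hI (isNoetherian_of_le (Submodule.torsionBySet_le_torsionBySet_of_subset
        (sup_le_sup_left hI.le 𝔞)) ) (X ⧸ K) (by
          refine sup_le (hX.trans (LinearMap.annihilator_le_of_surjective _ K.mkQ_surjective)) ?_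
          rw [Ideal.span_singleton_le_iff_mem, Module.mem_annihilator]
          intro a
          obtain ⟨a, rfl⟩ := K.mkQ_surjective a
          rw [← map_smul, Submodule.mkQ_apply, Submodule.Quotient.mk_eq_zero]
          exact ⟨a, rfl⟩)
      refine finite_genLocalHomology_of_smul_quotient 𝔞 N i x hx (genLocalHomologyMap 𝔞 N i K.mkQ)
        fun y hy => ?_
      obtain ⟨z, hz⟩ := (genLocalHomology_exact 𝔞 N i hinj (LinearMap.exact_map_mkQ_range _)
        K.mkQ_surjective y).1 hy
      exact ⟨z, (genLocalHomologyMap_lsmul 𝔞 N i x z).symm.trans hz⟩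
  | exact X₁ X X₂ f g hf hg hfg h₁ h₂ =>
    intro hX
    exact finite_genLocalHomology_middle 𝔞 N i hf hfg hg
      (h₁ (hX.trans (LinearMap.annihilator_le_of_injective f hf)))
      (h₂ (hX.trans (LinearMap.annihilator_le_of_surjective g hg)))

end LocalHomologyFinite

end LocalHom

end

/-! ### The theorem. -/

theorem corollary2p13 {R : Type u} [CommRing R] [IsNoetherianRing R] (𝔞 : Ideal R)
    (M N : Type u) [AddCommGroup M] [Module R M] [AddCommGroup N] [Module R N]
    [Module.Finite R M] [IsArtinian R N] :
    ((∀ i : ℕ, IsFiniteLength R (LocalHom.TorMod R M N i)) →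
      IsFiniteLength R (Submodule.torsionBySet R N (Module.annihilator R M))) ∧
    ((∀ i : ℕ, Module.Finite (AdicCompletion 𝔞 R) (LocalHom.genLocalHomology 𝔞 M N i)) →
      IsFiniteLength R (Submodule.torsionBySet R N (𝔞 ⊔ Module.annihilator R M : Ideal R))) ∧
    ((∀ i : ℕ, Module.Finite (AdicCompletion 𝔞 R) (LocalHom.localHomology 𝔞 N i)) →
      IsFiniteLength R (Submodule.torsionBySet R N 𝔞)) ∧
    (Finite (MaximalSpectrum R) → IsAdicComplete (⊥ : Ideal R).jacobson R →
      (IsFiniteLength R (Submodule.torsionBySet R N (Module.annihilator R M)) →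
        ∀ i : ℕ, IsFiniteLength R (LocalHom.TorMod R M N i)) ∧
      (IsFiniteLength R (Submodule.torsionBySet R N (𝔞 ⊔ Module.annihilator R M : Ideal R)) →
        ∀ i : ℕ, Module.Finite (AdicCompletion 𝔞 R) (LocalHom.genLocalHomology 𝔞 M N i)) ∧
      (IsFiniteLength R (Submodule.torsionBySet R N 𝔞) →
        ∀ i : ℕ, Module.Finite (AdicCompletion 𝔞 R) (LocalHom.localHomology 𝔞 N i))) := by
  have htor (i : ℕ) : IsArtinian R (LocalHom.TorMod R M N i) := LocalHom.isArtinian_tor i M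
  -- The statements on H_i^𝔞(N) are the case M = R, where Ann M = 0.
  have hR : 𝔞 ⊔ Module.annihilator R R = 𝔞 := by
    rw [Module.annihilator_eq_bot.2 inferInstance, sup_bot_eq]
  simp only [isFiniteLength_iff_isNoetherian_isArtinian, htor, and_true]
  refine ⟨fun h => ?_, fun h => ?_, fun h => ?_, fun _ _ => ⟨fun h i => ?_, fun h i => ?_,
    fun h i => ?_⟩⟩
  · refine ⟨?_, inferInstance⟩
    exact LocalHom.isNoetherian_torsionBySet_of_tor _ N fun X _ _ _ hX i =>
      LocalHom.isNoetherian_tor_of_annihilator M N h i X hX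
  · exact ⟨LocalHom.isNoetherian_torsionBySet_of_genLocalHomology 𝔞 N M h, inferInstance⟩
  · have := LocalHom.isNoetherian_torsionBySet_of_genLocalHomology 𝔞 N R h
    rw [hR] at this
    exact ⟨this, inferInstance⟩
  · exact LocalHom.isNoetherian_tor_of_torsionBySet _ N h.1 M le_rfl i
  · exact LocalHom.finite_genLocalHomology_of_torsionBySet 𝔞 N i _ h.1 M le_rfl
  · exact LocalHom.finite_genLocalHomology_of_torsionBySet 𝔞 N i (Module.annihilator R R)
      (hR.symm ▸ h.1) R le_rfl
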